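/- **Setting.** Let $p,d,n\ge 1$ be integers and $r=pd$. Let $G(r,1,n)$ be the group of unitary transformations of $V=\mathbb{C}^n$ given by monomial matrices whose nonzero entries are $r$-th roots of unity, and let $G(r,p,n)$ be the normal subgroup of index $p$ of those for which the product of the nonzero entries is a $d$-th root of unity. For a finite group $W$ of unitary transformations of $V$ and a function $c$ on the reflections of $W$ invariant under conjugation by $W$, the rational Cherednik algebra $H_c(W)$ is generated by $x\in V^*$, $y\in V$, $w\in W$ with $[x,x']=[y,y']=0$, $wxw^{-1}=w(x)$, $wyw^{-1}=w(y)$ and $$[y,x]=\langle y,x\rangle+\sum_{H}\frac{\langle\alpha_H,y\rangle\langle x,v_H\rangle}{\langle\alpha_H,v_H\rangle}\sum_{g\in W_H\setminus\{1\}}c_g\,g ,$$ where $H$ runs over the reflection hyperplanes, $W_H$ is the pointwise stabilizer of $H$, $v_H$ is a normal vector of $H$ and $\alpha_H=\langle v_H,\cdot\rangle$. For a representation $\sigma$ of $W$ the module $\mathbb{C}[V]\otimes\sigma$ is $\Delta(\sigma)=H_c(W)\otimes_{\mathbb{C}[V^*]\rtimes W}\sigma$, with $V$ acting by $0$ on $\sigma$;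 it is called a standard module if $\sigma$ is irreducible. For a family $\lambda=(\lambda^i_j)_{i\in\mathbb{Z}/p,\,0\le j<d}$ of Young diagrams with $n$ cells in total, let $V(\lambda)$ be the representation of $G(r,1,n)$ with basis $v(T)$, $T$ a standard tableau of shape $\lambda$, on which a diagonal matrix $\mathrm{diag}(\theta_1,\dots,\theta_n)$ acts by $v(T)\mapsto\prod_k\theta_k^{d i_k+j_k}\,v(T)$, where $(i_k,j_k)$, $0\le i_k<p$, is the index of the diagram containing $k$, and the permutation matrix of $(a,a+1)$ acts by Young's seminormal form $v(T)\mapsto\alpha v(T)+(1+\alpha)v(T')$. Here $\alpha=1/(\mathrm{ct}(a+1)-\mathrm{ct}(a))$, with $\mathrm{ct}$ the content, if $a,a+1$ lie in the same diagram, and $\alpha=0$ otherwise; $T'$ is $T$ with $a,a+1$ interchanged, and $v(T')=0$ if $T'$ is not standard. Let $\mathrm{shift}(\lambda)=(\lambda^{i+1}_j)$ and shift tableaux likewise, let $\bar\lambda$ be the orbit of $\lambda$ under $\mathrm{shift}$, and let $e_\lambda=p/|\bar\lambda|$. For $\mu\in\bar\lambda$ and $l\in\mathbb{Z}$ let $V(\bar\lambda,l)$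 be the eigenspace in $V(\mu)$ of the operator $v(T)\mapsto v(\mathrm{shift}^{p/e_\lambda}T)$ for the eigenvalue $e^{2\pi i l/e_\lambda}$, which is a $G(r,p,n)$-subrepresentation of $V(\mu)$. **Statement.** Let $c$ be a $G(r,1,n)$-invariant function on the reflections of $G(r,1,n)$ with $c_g=0$ for all reflections $g\in G(r,1,n)\setminus G(r,p,n)$, and let $\mathrm{Res}'_{r,p,n}$ be restriction along the algebra homomorphism $H_c(G(r,p,n))\to H_c(G(r,1,n))$ that is the identity on $V^*$, $V$ and $G(r,p,n)$. Then for every $\lambda$, and for every choice of representative $\mu$ of $\bar\lambda$, the representations $V(\bar\lambda,l)$, $1\le l\le e_\lambda$, of $G(r,p,n)$ are irreducible and $$\mathrm{Res}'_{r,p,n}\bigl(\mathbb{C}[V]\otimes V(\lambda)\bigr)\cong\bigoplus_{l=1}^{e_\lambda}\mathbb{C}[V]\otimes V(\bar\lambda,l)$$ as $H_c(G(r,p,n))$-modules. In particular, for $r=p=2$, that is for $W(B_n)=G(2,1,n)\supset W(D_n)=G(2,2,n)$ and $\lambda=(\lambda_1,\lambda_2)$ a bipartition of $n$: one has $e_\lambda=2$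 if and only if $\lambda_1=\lambda_2$. If $\lambda_1\ne\lambda_2$, then the restriction $V(\bar\lambda)$ of $V(\mu)$ to $W(D_n)$ is irreducible and the restriction of $\mathbb{C}[\mathbb{C}^n]\otimes V(\lambda)$ to $H_c(W(D_n))$ is $\mathbb{C}[\mathbb{C}^n]\otimes V(\bar\lambda)$. If $\lambda_1=\lambda_2$, then $V(\bar\lambda,0)$ and $V(\bar\lambda,1)$ are irreducible and the restriction is $\mathbb{C}[\mathbb{C}^n]\otimes V(\bar\lambda,0)\oplus\mathbb{C}[\mathbb{C}^n]\otimes V(\bar\lambda,1)$. -/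

import Mathlib

open scoped TensorProduct DirectSum


namespace ImprimitiveCherednik

theorem swap_val {n : ℕ} (a b x : Fin n) :
    ((Equiv.swap a b x : Fin n) : ℕ) =
      if (x : ℕ) = a then (b : ℕ) else if (x : ℕ) = b then (a : ℕ) else x := by
  rw [Equiv.swap_apply_def]
  simp only [Fin.ext_iff]
  split_ifs <;> rfl

/-- A family `s 0, …, s (n-2)` of elements of a monoid satisfying the Coxeter relations of the
symmetric group extends to a homomorphism from the symmetric group. -/
theorem exists_perm_lift {M : Type*} [Monoid M] : ∀ (n : ℕ) (s : ℕ → M),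
    (∀ i, i + 1 < n → s i * s i = 1) →
    (∀ i, i + 2 < n → s i * s (i + 1) * s i = s (i + 1) * s i * s (i + 1)) →
    (∀ i j, i + 1 < j → j + 1 < n → s i * s j = s j * s i) →
    ∃ f : Equiv.Perm (Fin n) →* M, ∀ (i : ℕ) (h : i + 1 < n),
      f (Equiv.swap ⟨i, Nat.lt_of_succ_lt h⟩ ⟨i + 1, h⟩) = s i := by
  intro n
  induction n with
  | zero => exact fun s _ _ _ => ⟨1, fun i h => absurd h (by omega)⟩
  | succ n ih =>
    intro s hsq hbr hcm
    obtain ⟨φ, hφ⟩ := ih (fun i => s (i + 1)) (fun i hi => hsq _ (by omega))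
      (fun i hi => hbr _ (by omega)) (fun i j hij hj => hcm _ _ (by omega) (by omega))
    let c : ℕ → M := fun k => Nat.rec 1 (fun i x => s i * x) k
    have hc : ∀ k, c (k + 1) = s k * c k := fun k => rfl
    have c_far : ∀ k i, k < i → i < n → s i * c k = c k * s i := by
      intro k
      induction k with
      | zero => intro i _ _; show s i * 1 = 1 * s i; simp
      | succ k ihk =>
        intro i hki hi
        rw [hc, ← mul_assoc, ← hcm k i (by omega) (by omega), mul_assoc, ihk i (by omega) hi,
          mul_assoc]
    have c_near : ∀ k i, i + 1 < k → k ≤ n → s i * c k = c k * s (i + 1) := by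
      intro k
      induction k with
      | zero => intro i h; omega
      | succ k ihk =>
        intro i hik hk
        rcases Nat.lt_or_ge (i + 1) k with h | h
        · rw [hc, ← mul_assoc, hcm i k h (by omega), mul_assoc, ihk i h (by omega), mul_assoc]
        · obtain rfl : k = i + 1 := by omega
          rw [hc, hc, ← mul_assoc, ← mul_assoc, hbr i (by omega), mul_assoc, mul_assoc,
            c_far i (i + 1) (by omega) (by omega)]
          simp only [mul_assoc]
    have hdec : ∀ σ : Equiv.Perm (Fin (n + 1)), ∃ e : Equiv.Perm (Fin n),
        ∀ i : Fin n, σ i.succ = (σ 0).succAbove (e i) := by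
      intro σ
      have h1 : ∀ i : Fin n, ∃ j, (σ 0).succAbove j = σ i.succ := fun i =>
        Fin.exists_succAbove_eq (fun h => absurd (σ.injective h) (Fin.succ_ne_zero i))
      choose g hg using h1
      have hinj : Function.Injective g := by
        intro a b hab
        have := hg a
        rw [hab, hg b] at this
        exact (Fin.succ_injective _ (σ.injective this)).symm
      exact ⟨Equiv.ofBijective g (Finite.injective_iff_bijective.mp hinj), fun i => (hg i).symm⟩
    choose e he using hdec
    have he_unique : ∀ σ (g : Equiv.Perm (Fin n)),
        (∀ i : Fin n, σ i.succ = (σ 0).succAbove (g i)) → e σ = g := by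
      intro σ g hg
      ext1 i
      exact Fin.succAbove_right_injective ((he σ i).symm.trans (hg i))
    let F : Equiv.Perm (Fin (n + 1)) → M := fun σ => c (σ 0) * φ (e σ)
    have hF1 : F 1 = 1 := by
      have h : e 1 = 1 := he_unique 1 1 (fun i => by simp)
      show c ((1 : Equiv.Perm (Fin (n + 1))) 0) * φ (e 1) = 1
      rw [h]
      simp [c]
    have hsv : ∀ (k : Fin (n + 1)) (j : Fin n),
        ((k.succAbove j : Fin (n + 1)) : ℕ) = if (j : ℕ) < k then (j : ℕ) else j + 1 := by
      intro k j
      rw [Fin.succAbove]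
      simp only [Fin.lt_def, Fin.val_castSucc]
      split_ifs <;> rfl
    have hF : ∀ (i : ℕ) (h : i + 1 < n + 1) (σ : Equiv.Perm (Fin (n + 1))),
        F (Equiv.swap ⟨i, Nat.lt_of_succ_lt h⟩ ⟨i + 1, h⟩ * σ) = s i * F σ := by
      intro i h σ
      set t : Equiv.Perm (Fin (n + 1)) := Equiv.swap ⟨i, Nat.lt_of_succ_lt h⟩ ⟨i + 1, h⟩ with ht
      have htv : ∀ x : Fin (n + 1), ((t x : Fin (n + 1)) : ℕ) =
          if (x : ℕ) = i then i + 1 else if (x : ℕ) = i + 1 then i else x := by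
        intro x
        exact swap_val _ _ x
      show c ((t * σ) 0) * φ (e (t * σ)) = s i * (c (σ 0) * φ (e σ))
      rcases lt_trichotomy ((σ 0 : Fin (n + 1)) : ℕ) i with hk | hk | hk
      · obtain ⟨i, rfl⟩ : ∃ i', i = i' + 1 := ⟨i - 1, by omega⟩
        have h0 : (t * σ) 0 = σ 0 := by
          apply Fin.ext; rw [Equiv.Perm.mul_apply, htv]; split_ifs <;> omega
        have h1 : e (t * σ) = Equiv.swap ⟨i, by omega⟩ ⟨i + 1, by omega⟩ * e σ := by
          apply he_unique
          intro j
          rw [h0, Equiv.Perm.mul_apply, Equiv.Perm.mul_apply, he]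
          apply Fin.ext
          rw [htv, hsv, hsv, swap_val]
          dsimp only
          split_ifs <;> omega
        rw [h0, h1, map_mul, hφ i (by omega), ← mul_assoc, ← mul_assoc, c_far _ _ hk (by omega)]
      · have h0 : (((t * σ) 0 : Fin (n + 1)) : ℕ) = i + 1 := by
          rw [Equiv.Perm.mul_apply, htv, if_pos hk]
        have h1 : e (t * σ) = e σ := by
          apply he_unique
          intro j
          rw [Equiv.Perm.mul_apply, he]
          apply Fin.ext
          rw [htv, hsv, hsv, h0, hk]
          split_ifs <;> omega
        rw [h0, h1, hc, hk, mul_assoc]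
      · rcases Nat.lt_or_ge (i + 1) (σ 0 : Fin (n + 1)) with hk' | hk'
        · have h0 : (t * σ) 0 = σ 0 := by
            apply Fin.ext; rw [Equiv.Perm.mul_apply, htv]; split_ifs <;> omega
          have hlt := (σ 0).isLt
          have h1 : e (t * σ) = Equiv.swap ⟨i, by omega⟩ ⟨i + 1, by omega⟩ * e σ := by
            apply he_unique
            intro j
            rw [h0, Equiv.Perm.mul_apply, Equiv.Perm.mul_apply, he]
            apply Fin.ext
            rw [htv, hsv, hsv, swap_val]
            dsimp only
            split_ifs <;> omega
          rw [h0, h1, map_mul, hφ i (by omega), ← mul_assoc, ← mul_assoc,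
            c_near _ _ hk' (by omega)]
        · have hk2 : ((σ 0 : Fin (n + 1)) : ℕ) = i + 1 := by omega
          have h0 : (((t * σ) 0 : Fin (n + 1)) : ℕ) = i := by
            rw [Equiv.Perm.mul_apply, htv]; split_ifs <;> omega
          have h1 : e (t * σ) = e σ := by
            apply he_unique
            intro j
            rw [Equiv.Perm.mul_apply, he]
            apply Fin.ext
            rw [htv, hsv, hsv, h0, hk2]
            split_ifs <;> omega
          rw [h0, h1, hk2, hc, ← mul_assoc, ← mul_assoc, hsq i h, one_mul]
    have hmul : ∀ σ τ, F (σ * τ) = F σ * F τ := by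
      intro σ
      have hσ : σ ∈ Submonoid.closure
          (Set.range fun i : Fin n => Equiv.swap i.castSucc i.succ) := by
        rw [Equiv.Perm.mclosure_swap_castSucc_succ]; trivial
      induction hσ using Submonoid.closure_induction with
      | one => intro τ; rw [one_mul, hF1, one_mul]
      | mem x hx =>
        obtain ⟨i, rfl⟩ := hx
        intro τ
        have h := hF i (by omega)
        have h1 := h 1
        rw [mul_one, hF1, mul_one] at h1
        exact (h τ).trans (congrArg (· * F τ) h1.symm)
      | mul x y _ _ hx hy => intro τ; rw [mul_assoc, hx, hy, hx]; exact (mul_assoc (F x) (F y) (F τ)).symm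
    refine ⟨⟨⟨F, hF1⟩, hmul⟩, fun i h => ?_⟩
    have := hF i h 1
    rwa [mul_one, hF1, mul_one] at this

/-! ### Multipartitions, standard tableaux and the modules `V(λ)` -/

/-- A `p * d`-tuple `(λ^i_j)`, `i ∈ ℤ/p`, `0 ≤ j < d`, of Young diagrams with `n` cells in total. -/
@[ext]
structure MultiPartition (p d n : ℕ) [NeZero p] where
  shape : ZMod p → Fin d → YoungDiagram
  card_eq : ∑ i, ∑ j, (shape i j).card = n

/-- A cell of a multipartition: the index `(i, j)` of the diagram, then (row, column). -/
abbrev Box (p d : ℕ) := (ZMod p × Fin d) × (ℕ × ℕ)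

section Tableaux

variable {p d n : ℕ} [NeZero p]

/-- The shift operator `(λ^i_j) ↦ (λ^{i+1}_j)`. -/
def MultiPartition.shift (lam : MultiPartition p d n) : MultiPartition p d n where
  shape i j := lam.shape (i + 1) j
  card_eq := (Equiv.sum_comp (Equiv.addRight (1 : ZMod p))
    fun i => ∑ j, (lam.shape i j).card).trans lam.card_eq

/-- Two multipartitions are cyclically equivalent if some power of the shift maps one to the
other. -/
def CyclicEquiv (lam mu : MultiPartition p d n) : Prop :=
  ∃ k : ℕ, MultiPartition.shift^[k] lam = mu

/-- The number `e_λ = p / |λ̄|`, where `λ̄` is the cyclic equivalence class of `λ`. -/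
noncomputable def eNumber (lam : MultiPartition p d n) : ℕ :=
  p / {mu | CyclicEquiv lam mu}.ncard

/-- A filling `f` (the number `k` sits in the cell `f k`) is a standard tableau of shape `λ` if it
is a bijection onto the cells of `λ` and the numbers increase along rows and columns. -/
structure IsStd (lam : MultiPartition p d n) (f : Fin n → Box p d) : Prop where
  inj : Function.Injective f
  range_iff : ∀ b : Box p d, (∃ k, f k = b) ↔ b.2 ∈ lam.shape b.1.1 b.1.2
  mono : ∀ k l, (f k).1 = (f l).1 → (f k).2 ≤ (f l).2 → k ≤ l

/-- Standard tableaux of shape `λ`. -/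
abbrev StdTableau (lam : MultiPartition p d n) := {f : Fin n → Box p d // IsStd lam f}

/-- The vector space `V(λ)` with basis the symbols `v(T)`, `T` a standard tableau of shape `λ`. -/
abbrev VMod (lam : MultiPartition p d n) := StdTableau lam →₀ ℂ

open scoped Classical in
/-- The basis vector `v(f)` if `f` is a standard tableau of shape `λ`, and `0` otherwise. -/
noncomputable def vec (lam : MultiPartition p d n) (f : Fin n → Box p d) : VMod lam :=
  if h : IsStd lam f then Finsupp.single ⟨f, h⟩ 1 else 0

/-- The content (column minus row) of the number `k` in the filling `f`. -/
def content (f : Fin n → Box p d) (k : Fin n) : ℤ := ((f k).2.2 : ℤ) - (f k).2.1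

open scoped Classical in
/-- `1 / (c(b) - c(a))` if `a`, `b` lie in the same diagram, and `0` otherwise. -/
noncomputable def axial (f : Fin n → Box p d) (a b : Fin n) : ℂ :=
  if (f a).1 = (f b).1 then ((content f b - content f a : ℤ) : ℂ)⁻¹ else 0

/-- Young's seminormal form, for the transposition of `a` and `b = a + 1`:
`v(T) ↦ α v(T) + (1 + α) v(T')`, where `α = 1 / (c(b) - c(a))` if `a` and `b` lie in the same
diagram and `α = 0` otherwise, and `T'` is `T` with `a` and `b` interchanged
(`v(T') = 0` if `T'` is not standard). -/
noncomputable def swapOp (lam : MultiPartition p d n) (a b : Fin n) : Module.End ℂ (VMod lam) :=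
  Finsupp.linearCombination ℂ fun T : StdTableau lam =>
    axial T.1 a b • vec lam T.1 + (1 + axial T.1 a b) • vec lam (T.1 ∘ Equiv.swap a b)

/-- The diagonal matrix with entries `θ k` acts on `v(T)` by the product over `k` of
`(θ k) ^ (d * i + j)`, where `(i, j)` is the index of the diagram containing `k`. -/
noncomputable def torusOp (lam : MultiPartition p d n) (θ : Fin n → ℂ) :
    Module.End ℂ (VMod lam) :=
  Finsupp.linearCombination ℂ fun T : StdTableau lam =>
    (∏ k, θ k ^ (d * (T.1 k).1.1.val + ((T.1 k).1.2 : ℕ))) • vec lam T.1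

theorem vec_std {lam : MultiPartition p d n} (T : StdTableau lam) :
    vec lam T.1 = Finsupp.single T 1 := by
  rw [vec, dif_pos T.2]

theorem vec_not {lam : MultiPartition p d n} {f : Fin n → Box p d} (h : ¬ IsStd lam f) :
    vec lam f = 0 := by
  rw [vec, dif_neg h]

theorem end_ext {lam : MultiPartition p d n} {N : Type*} [AddCommMonoid N] [Module ℂ N]
    {A B : VMod lam →ₗ[ℂ] N} (h : ∀ f, IsStd lam f → A (vec lam f) = B (vec lam f)) : A = B := by
  refine Finsupp.lhom_ext' fun T => LinearMap.ext_ring ?_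
  have := h T.1 T.2
  rw [vec_std] at this
  exact this

theorem axial_swap (f : Fin n → Box p d) (a b : Fin n) : axial f b a = - axial f a b := by
  unfold axial
  by_cases h : (f a).1 = (f b).1
  · rw [if_pos h, if_pos h.symm, ← inv_neg]; push_cast; ring_nf
  · rw [if_neg h, if_neg (fun h' => h h'.symm), neg_zero]

theorem axial_comp (f : Fin n → Box p d) (s : Fin n → Fin n) (a b : Fin n) :
    axial (f ∘ s) a b = axial f (s a) (s b) := rfl

theorem IsStd.range_comp {lam : MultiPartition p d n} {f : Fin n → Box p d} (hf : IsStd lam f)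
    (s : Equiv.Perm (Fin n)) :
    Function.Injective (f ∘ s) ∧
      ∀ b : Box p d, (∃ k, (f ∘ s) k = b) ↔ b.2 ∈ lam.shape b.1.1 b.1.2 :=
  ⟨hf.inj.comp s.injective, fun b => by
    rw [← hf.range_iff]
    exact ⟨fun ⟨k, hk⟩ => ⟨s k, hk⟩, fun ⟨k, hk⟩ => ⟨s.symm k, by simpa using hk⟩⟩⟩

/-- In a standard tableau every cell weakly north-west of an occupied cell is occupied by a number
that is at most as large. -/
theorem IsStd.exists_le {lam : MultiPartition p d n} {f : Fin n → Box p d} (hf : IsStd lam f)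
    (k : Fin n) (x : ℕ × ℕ) (hx : x ≤ (f k).2) : ∃ m, f m = ((f k).1, x) ∧ m ≤ k := by
  have h1 : x ∈ lam.shape (f k).1.1 (f k).1.2 :=
    (lam.shape _ _).isLowerSet hx ((hf.range_iff (f k)).1 ⟨k, rfl⟩)
  obtain ⟨m, hm⟩ := (hf.range_iff ((f k).1, x)).2 h1
  exact ⟨m, hm, hf.mono m k (by rw [hm]) (by rw [hm]; exact hx)⟩

theorem IsStd.content_lt {lam : MultiPartition p d n} {f : Fin n → Box p d} (hf : IsStd lam f)
    {a b : Fin n} (hab : a < b) (hc : (f a).1 = (f b).1) (h : content f a = content f b) :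
    (a : ℕ) + 3 ≤ b := by
  unfold content at h
  have hne : (f a).2 ≠ (f b).2 := fun h' => hab.ne (hf.inj (Prod.ext hc h'))
  have hlt : (f a).2.1 < (f b).2.1 := by
    by_contra hcon
    have : b ≤ a := hf.mono b a hc.symm (Prod.le_def.2 ⟨by omega, by omega⟩)
    exact absurd hab (not_lt.2 this)
  obtain ⟨m, hm, hmb⟩ := hf.exists_le b ((f a).2.1 + 1, (f a).2.2)
    (Prod.le_def.2 ⟨by simp; omega, by simp; omega⟩)
  obtain ⟨l, hl, hlb⟩ := hf.exists_le b ((f a).2.1, (f a).2.2 + 1)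
    (Prod.le_def.2 ⟨by simp; omega, by simp; omega⟩)
  have ham : a ≤ m := hf.mono a m (by rw [hm, hc]) (by rw [hm]; exact Prod.le_def.2 ⟨by simp, le_rfl⟩)
  have hal : a ≤ l := hf.mono a l (by rw [hl, hc]) (by rw [hl]; exact Prod.le_def.2 ⟨le_rfl, by simp⟩)
  have h1 : m ≠ a := by
    intro h'; rw [h'] at hm; have := congrArg (fun x : Box p d => x.2.1) hm; simp at this
  have h2 : l ≠ a := by
    intro h'; rw [h'] at hl; have := congrArg (fun x : Box p d => x.2.2) hl; simp at this
  have h3 : m ≠ b := by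
    intro h'; rw [h'] at hm; have := congrArg (fun x : Box p d => x.2.2) hm; simp at this; omega
  have h4 : l ≠ b := by
    intro h'; rw [h'] at hl; have := congrArg (fun x : Box p d => x.2.1) hl; simp at this; omega
  have h5 : m ≠ l := by
    intro h'; rw [h', hl] at hm; have := congrArg (fun x : Box p d => x.2.1) hm; simp at this
  simp only [Fin.le_def, Fin.ext_iff, ne_eq] at *
  omega

theorem IsStd.axial_sq {lam : MultiPartition p d n} {f : Fin n → Box p d} (hf : IsStd lam f)
    {a b : Fin n} (hab : (a : ℕ) + 1 = b) (hs : ¬ IsStd lam (f ∘ Equiv.swap a b)) :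
    axial f a b ^ 2 = 1 := by
  have hcomp := hf.range_comp (Equiv.swap a b)
  have : ∃ k l, (f k).1 = (f l).1 ∧ (f k).2 ≤ (f l).2 ∧
      ¬ (Equiv.swap a b k ≤ Equiv.swap a b l) := by
    by_contra hcon
    push Not at hcon
    refine hs ⟨hcomp.1, hcomp.2, fun k l h1 h2 => ?_⟩
    simpa using hcon _ _ h1 h2
  obtain ⟨k, l, h1, h2, h3⟩ := this
  have hkl := hf.mono k l h1 h2
  have hk : k = a ∧ l = b := by
    simp only [Fin.le_def, swap_val, Fin.ext_iff] at *
    split_ifs at h3 <;> omega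
  obtain ⟨rfl, rfl⟩ := hk
  have hne : k ≠ l := fun h => by rw [h] at hab; omega
  have key : content f l - content f k = 1 ∨ content f l - content f k = -1 := by
    unfold content
    have h21 := (Prod.le_def.1 h2).1
    have h22 := (Prod.le_def.1 h2).2
    rcases Nat.lt_or_ge (f k).2.1 (f l).2.1 with h | h
    · obtain ⟨m, hm, hml⟩ := hf.exists_le l ((f k).2.1 + 1, (f k).2.2)
        (Prod.le_def.2 ⟨by simp; omega, by simp; omega⟩)
      have hkm : k ≤ m := hf.mono k m (by rw [hm, h1])
        (by rw [hm]; exact Prod.le_def.2 ⟨by simp, le_rfl⟩)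
      have hmk : m ≠ k := by
        intro h'; rw [h'] at hm; have := congrArg (fun x : Box p d => x.2.1) hm; simp at this
      have : m = l := by
        simp only [Fin.le_def, Fin.ext_iff, ne_eq] at *; omega
      rw [this] at hm
      have e1 := congrArg (fun x : Box p d => x.2.1) hm
      have e2 := congrArg (fun x : Box p d => x.2.2) hm
      simp only at e1 e2
      right; omega
    · rcases Nat.lt_or_ge (f k).2.2 (f l).2.2 with h' | h'
      · obtain ⟨m, hm, hml⟩ := hf.exists_le l ((f k).2.1, (f k).2.2 + 1)
          (Prod.le_def.2 ⟨by simp; omega, by simp; omega⟩)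
        have hkm : k ≤ m := hf.mono k m (by rw [hm, h1])
          (by rw [hm]; exact Prod.le_def.2 ⟨le_rfl, by simp⟩)
        have hmk : m ≠ k := by
          intro h'; rw [h'] at hm; have := congrArg (fun x : Box p d => x.2.2) hm; simp at this
        have : m = l := by
          simp only [Fin.le_def, Fin.ext_iff, ne_eq] at *; omega
        rw [this] at hm
        have e1 := congrArg (fun x : Box p d => x.2.1) hm
        have e2 := congrArg (fun x : Box p d => x.2.2) hm
        simp only at e1 e2
        left; omega
      · exact absurd (hf.inj (Prod.ext h1 (Prod.ext (by omega) (by omega)))) hne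
  unfold axial
  rw [if_pos h1]
  rcases key with h | h <;> rw [h] <;> norm_num

open scoped Classical in
/-- The coefficient `1 + α`, replaced by `0` when `α = ±1`. -/
noncomputable def coeffAux (α : ℂ) : ℂ := if α ^ 2 = 1 then 0 else 1 + α

theorem coeffAux_mul (α : ℂ) : coeffAux α * coeffAux (-α) = 1 - α ^ 2 := by
  unfold coeffAux
  by_cases h : α ^ 2 = 1
  · rw [if_pos h, h]; ring
  · rw [if_neg h, if_neg (by rwa [neg_sq])]; ring

theorem swapOp_vec (lam : MultiPartition p d n) {a b : Fin n} (hab : (a : ℕ) + 1 = b)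
    (f : Fin n → Box p d) :
    swapOp lam a b (vec lam f) =
      axial f a b • vec lam f + coeffAux (axial f a b) • vec lam (f ∘ Equiv.swap a b) := by
  by_cases hf : IsStd lam f
  · have h1 : swapOp lam a b (vec lam f) =
        axial f a b • vec lam f + (1 + axial f a b) • vec lam (f ∘ Equiv.swap a b) := by
      have := vec_std (⟨f, hf⟩ : StdTableau lam)
      simp only at this
      rw [swapOp, this, Finsupp.linearCombination_single, one_smul, this]
    rw [h1]
    congr 1
    unfold coeffAux
    split_ifs with h
    · have : ¬ IsStd lam (f ∘ Equiv.swap a b) := by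
        intro hs
        by_cases hc : (f a).1 = (f b).1
        · rw [axial, if_pos hc] at h
          have hd : content f b - content f a = 1 ∨ content f b - content f a = -1 := by
            rw [inv_pow, inv_eq_one] at h
            exact sq_eq_one_iff.1 (by exact_mod_cast h)
          have n1 : ¬ (f a).2 ≤ (f b).2 := fun hle => by
            have := hs.mono b a (by simpa using hc) (by simpa using hle)
            rw [Fin.le_def] at this; omega
          have n2 : ¬ (f b).2 ≤ (f a).2 := fun hle => by
            have := hf.mono b a hc.symm hle
            rw [Fin.le_def] at this; omega
          rw [Prod.le_def] at n1 n2
          unfold content at hd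
          omega
        · rw [axial, if_neg hc] at h; norm_num at h
      rw [vec_not this, smul_zero, smul_zero]
    · rfl
  · rw [vec_not hf, map_zero, smul_zero, zero_add]
    by_cases hs : IsStd lam (f ∘ Equiv.swap a b)
    · have h2 := hs.axial_sq hab (by
        rwa [Function.comp_assoc, ← Equiv.Perm.coe_mul, Equiv.swap_mul_self, Equiv.Perm.coe_one,
          Function.comp_id])
      rw [axial_comp, Equiv.swap_apply_left, Equiv.swap_apply_right, axial_swap, neg_sq] at h2
      rw [coeffAux, if_pos h2, zero_smul]
    · rw [vec_not hs, smul_zero]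

theorem swapOp_sq (lam : MultiPartition p d n) {a b : Fin n} (hab : (a : ℕ) + 1 = b) :
    swapOp lam a b * swapOp lam a b = 1 := by
  refine end_ext fun f _ => ?_
  have e1 : (f ∘ Equiv.swap a b) ∘ Equiv.swap a b = f := by
    funext x; simp
  have h := coeffAux_mul (axial f a b)
  rw [Module.End.mul_apply, swapOp_vec lam hab, map_add, map_smul, map_smul, swapOp_vec lam hab,
    swapOp_vec lam hab, e1, axial_comp, Equiv.swap_apply_left, Equiv.swap_apply_right,
    axial_swap f a b, Module.End.one_apply]
  match_scalars
  · linear_combination h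
  · ring

theorem swapOp_comm (lam : MultiPartition p d n) {a b c e : Fin n} (hab : (a : ℕ) + 1 = b)
    (hbc : (b : ℕ) < c) (hce : (c : ℕ) + 1 = e) :
    swapOp lam a b * swapOp lam c e = swapOp lam c e * swapOp lam a b := by
  refine end_ext fun f _ => ?_
  have hac : a ≠ c := by rw [Ne, Fin.ext_iff]; omega
  have hae : a ≠ e := by rw [Ne, Fin.ext_iff]; omega
  have hbc' : b ≠ c := by rw [Ne, Fin.ext_iff]; omega
  have hbe : b ≠ e := by rw [Ne, Fin.ext_iff]; omega
  have e1 : (f ∘ Equiv.swap a b) ∘ Equiv.swap c e = (f ∘ Equiv.swap c e) ∘ Equiv.swap a b := by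
    funext x
    simp only [Function.comp_apply, Equiv.swap_apply_def]
    congr 1
    split_ifs <;> simp_all
  simp only [Module.End.mul_apply, swapOp_vec lam hab, swapOp_vec lam hce, map_add, map_smul,
    axial_comp, e1, Equiv.swap_apply_of_ne_of_ne hac hae, Equiv.swap_apply_of_ne_of_ne hbc' hbe,
    Equiv.swap_apply_of_ne_of_ne hac.symm hbc'.symm, Equiv.swap_apply_of_ne_of_ne hae.symm hbe.symm]
  match_scalars <;> ring

theorem axial_identity {lam : MultiPartition p d n} {f : Fin n → Box p d} (hf : IsStd lam f)
    {a b c : Fin n} (hab : (a : ℕ) + 1 = b) (hbc : (b : ℕ) + 1 = c) :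
    axial f a b * axial f b c = axial f a c * (axial f a b + axial f b c) := by
  unfold axial
  by_cases h1 : (f a).1 = (f b).1
  · by_cases h2 : (f b).1 = (f c).1
    · rw [if_pos h1, if_pos h2, if_pos (h1.trans h2)]
      have n1 : ((content f b - content f a : ℤ) : ℂ) ≠ 0 := by
        rw [Int.cast_ne_zero, sub_ne_zero]
        intro h
        have := hf.content_lt (Fin.lt_def.2 (by omega)) h1 h.symm
        omega
      have n2 : ((content f c - content f b : ℤ) : ℂ) ≠ 0 := by
        rw [Int.cast_ne_zero, sub_ne_zero]
        intro h
        have := hf.content_lt (Fin.lt_def.2 (by omega)) h2 h.symm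
        omega
      have n3 : ((content f c - content f a : ℤ) : ℂ) ≠ 0 := by
        rw [Int.cast_ne_zero, sub_ne_zero]
        intro h
        have := hf.content_lt (Fin.lt_def.2 (by omega)) (h1.trans h2) h.symm
        omega
      field_simp
      push_cast
      ring
    · rw [if_neg h2, if_neg (fun h => h2 (h1.symm.trans h))]; ring
  · by_cases h2 : (f b).1 = (f c).1
    · rw [if_neg h1, if_pos h2, if_neg (fun h => h1 (h.trans h2.symm))]; ring
    · rw [if_neg h1, if_neg h2]; ring

theorem swapOp_braid (lam : MultiPartition p d n) {a b c : Fin n} (hab : (a : ℕ) + 1 = b)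
    (hbc : (b : ℕ) + 1 = c) :
    swapOp lam a b * swapOp lam b c * swapOp lam a b =
      swapOp lam b c * swapOp lam a b * swapOp lam b c := by
  refine end_ext fun f hf => ?_
  have nab : a ≠ b := by rw [Ne, Fin.ext_iff]; omega
  have nac : a ≠ c := by rw [Ne, Fin.ext_iff]; omega
  have nbc : b ≠ c := by rw [Ne, Fin.ext_iff]; omega
  have e1 : (f ∘ Equiv.swap a b) ∘ Equiv.swap a b = f := by
    funext x; simp
  have e2 : (f ∘ Equiv.swap b c) ∘ Equiv.swap b c = f := by
    funext x; simp
  have e3 : ((f ∘ Equiv.swap a b) ∘ Equiv.swap b c) ∘ Equiv.swap a b =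
      ((f ∘ Equiv.swap b c) ∘ Equiv.swap a b) ∘ Equiv.swap b c := by
    funext x
    simp only [Function.comp_apply, Equiv.swap_apply_def]
    congr 1
    split_ifs <;> simp_all
  have v1 : Equiv.swap a b c = c := Equiv.swap_apply_of_ne_of_ne nac.symm nbc.symm
  have v2 : Equiv.swap b c a = a := Equiv.swap_apply_of_ne_of_ne nab nac
  have h1 := coeffAux_mul (axial f a b)
  have h2 := coeffAux_mul (axial f b c)
  have h3 := axial_identity hf hab hbc
  simp only [Module.End.mul_apply, swapOp_vec lam hab, swapOp_vec lam hbc, map_add, map_smul,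
    axial_comp, Equiv.swap_apply_left, Equiv.swap_apply_right, v1, v2, e1, e2,
    e3, axial_swap f a b, axial_swap f b c]
  generalize axial f a b = x at *
  generalize axial f b c = y at *
  generalize axial f a c = z at *
  match_scalars
  · linear_combination z * h1 - z * h2 + (x - y) * h3
  · linear_combination coeffAux x * h3
  · linear_combination (-coeffAux y) * h3
  · ring
  · ring
  · ring

theorem torusOp_vec (lam : MultiPartition p d n) (θ : Fin n → ℂ) (f : Fin n → Box p d) :
    torusOp lam θ (vec lam f) =
      (∏ k, θ k ^ (d * (f k).1.1.val + ((f k).1.2 : ℕ))) • vec lam f := by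
  by_cases hf : IsStd lam f
  · have := vec_std (⟨f, hf⟩ : StdTableau lam)
    simp only at this
    rw [torusOp, this, Finsupp.linearCombination_single, one_smul, this]
  · rw [vec_not hf, map_zero, smul_zero]

theorem torusOp_one (lam : MultiPartition p d n) : torusOp lam (fun _ => 1) = 1 := by
  refine end_ext fun f _ => ?_
  rw [torusOp_vec]
  simp

theorem torusOp_mul (lam : MultiPartition p d n) (θ θ' : Fin n → ℂ) :
    torusOp lam (fun i => θ i * θ' i) = torusOp lam θ * torusOp lam θ' := by
  refine end_ext fun f _ => ?_
  rw [Module.End.mul_apply, torusOp_vec, torusOp_vec, map_smul, torusOp_vec, smul_smul,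
    ← Finset.prod_mul_distrib]
  congr 1
  exact Finset.prod_congr rfl fun k _ => by rw [mul_pow, mul_comm]

theorem swapOp_torusOp (lam : MultiPartition p d n) {a b : Fin n} (hab : (a : ℕ) + 1 = b)
    (θ : Fin n → ℂ) :
    swapOp lam a b * torusOp lam θ =
      torusOp lam (fun i => θ (Equiv.swap a b i)) * swapOp lam a b := by
  refine end_ext fun f _ => ?_
  have h1 : (∏ k, θ (Equiv.swap a b k) ^ (d * ((f ∘ Equiv.swap a b) k).1.1.val +
      (((f ∘ Equiv.swap a b) k).1.2 : ℕ))) =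
      ∏ k, θ k ^ (d * (f k).1.1.val + ((f k).1.2 : ℕ)) :=
    Equiv.prod_comp (Equiv.swap a b) fun k => θ k ^ (d * (f k).1.1.val + ((f k).1.2 : ℕ))
  have h2 : axial f a b * (∏ k, θ (Equiv.swap a b k) ^ (d * (f k).1.1.val + ((f k).1.2 : ℕ))) =
      axial f a b * ∏ k, θ k ^ (d * (f k).1.1.val + ((f k).1.2 : ℕ)) := by
    by_cases hc : (f a).1 = (f b).1
    · rw [← h1]
      congr 1
      refine Finset.prod_congr rfl fun k _ => ?_
      have : ((f ∘ Equiv.swap a b) k).1 = (f k).1 := by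
        simp only [Function.comp_apply, Equiv.swap_apply_def]
        split_ifs with h h'
        · rw [h, hc]
        · rw [h', hc]
        · rfl
      rw [this]
    · rw [axial, if_neg hc, zero_mul, zero_mul]
  rw [Module.End.mul_apply, Module.End.mul_apply, torusOp_vec, map_smul, swapOp_vec lam hab,
    map_add, map_smul, map_smul, torusOp_vec, torusOp_vec, h1, smul_smul, h2, smul_add, smul_smul,
    smul_comm, mul_comm]

theorem exists_permRep (lam : MultiPartition p d n) :
    ∃ f : Equiv.Perm (Fin n) →* Module.End ℂ (VMod lam), ∀ (i : ℕ) (h : i + 1 < n),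
      f (Equiv.swap ⟨i, Nat.lt_of_succ_lt h⟩ ⟨i + 1, h⟩) =
        swapOp lam ⟨i, Nat.lt_of_succ_lt h⟩ ⟨i + 1, h⟩ := by
  obtain ⟨f, hf⟩ := exists_perm_lift n
    (fun i => if h : i + 1 < n then swapOp lam ⟨i, Nat.lt_of_succ_lt h⟩ ⟨i + 1, h⟩ else 1)
    (fun i h => by
      simp only [dif_pos h]
      exact swapOp_sq lam rfl)
    (fun i h => by
      simp only [dif_pos h, dif_pos (show i + 1 < n by omega)]
      exact swapOp_braid lam rfl rfl)
    (fun i j hij hj => by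
      simp only [dif_pos hj, dif_pos (show i + 1 < n by omega)]
      exact swapOp_comm lam rfl hij rfl)
  exact ⟨f, fun i h => by rw [hf i h, dif_pos h]⟩

/-- The action of the permutation matrices on `V(λ)`: the representation of the symmetric group in
which each adjacent transposition acts by `swapOp`. -/
noncomputable def permRep (lam : MultiPartition p d n) :
    Equiv.Perm (Fin n) →* Module.End ℂ (VMod lam) :=
  (exists_permRep lam).choose

theorem permRep_swap (lam : MultiPartition p d n) (i : ℕ) (h : i + 1 < n) :
    permRep lam (Equiv.swap ⟨i, Nat.lt_of_succ_lt h⟩ ⟨i + 1, h⟩) =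
      swapOp lam ⟨i, Nat.lt_of_succ_lt h⟩ ⟨i + 1, h⟩ :=
  (exists_permRep lam).choose_spec i h

/-- Induction on permutations, by left multiplication with adjacent transpositions. -/
theorem perm_induction {n : ℕ} {P : Equiv.Perm (Fin n) → Prop} (h1 : P 1)
    (hs : ∀ (i : ℕ) (h : i + 1 < n), P (Equiv.swap ⟨i, Nat.lt_of_succ_lt h⟩ ⟨i + 1, h⟩))
    (hm : ∀ σ τ, P σ → P τ → P (σ * τ)) (σ : Equiv.Perm (Fin n)) : P σ := by
  cases n with
  | zero => rwa [Subsingleton.elim σ 1]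
  | succ n =>
    have hσ : σ ∈ Submonoid.closure
        (Set.range fun i : Fin n => Equiv.swap i.castSucc i.succ) := by
      rw [Equiv.Perm.mclosure_swap_castSucc_succ]; trivial
    induction hσ using Submonoid.closure_induction with
    | one => exact h1
    | mem x hx => obtain ⟨i, rfl⟩ := hx; exact hs i (by omega)
    | mul x y _ _ hx hy => exact hm _ _ hx hy

theorem permRep_torusOp (lam : MultiPartition p d n) (σ : Equiv.Perm (Fin n)) :
    ∀ θ : Fin n → ℂ, permRep lam σ * torusOp lam θ =
      torusOp lam (fun i => θ (σ.symm i)) * permRep lam σ := by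
  refine perm_induction (P := fun σ => ∀ θ : Fin n → ℂ, permRep lam σ * torusOp lam θ =
      torusOp lam (fun i => θ (σ.symm i)) * permRep lam σ) ?_ ?_ ?_ σ
  · intro θ; rw [map_one, one_mul, mul_one]; rfl
  · intro i h θ
    rw [permRep_swap, swapOp_torusOp lam rfl, Equiv.symm_swap]
  · intro σ τ hσ hτ θ
    rw [map_mul, mul_assoc, hτ, ← mul_assoc, hσ, mul_assoc]; rfl

/-- The shift of fillings `(T^i_j) ↦ (T^{i+1}_j)`, iterated `m` times: a number in the diagram with
index `(i, j)` moves to the same cell of the diagram with index `(i - m, j)`. -/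
def shiftFilling (m : ℕ) (f : Fin n → Box p d) : Fin n → Box p d :=
  fun k => (((f k).1.1 - (m : ZMod p), (f k).1.2), (f k).2)

/-- The linear map `v(T) ↦ v(shift^m T)` on `V(λ)`; used for `m` with `shift^m λ = λ`. -/
noncomputable def shiftOp (lam : MultiPartition p d n) (m : ℕ) : Module.End ℂ (VMod lam) :=
  Finsupp.linearCombination ℂ fun T : StdTableau lam => vec lam (shiftFilling m T.1)

theorem shiftOp_vec {lam : MultiPartition p d n} (m : ℕ) {f : Fin n → Box p d}
    (hf : IsStd lam f) : shiftOp lam m (vec lam f) = vec lam (shiftFilling m f) := by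
  have := vec_std (⟨f, hf⟩ : StdTableau lam)
  simp only at this
  rw [shiftOp, this, Finsupp.linearCombination_single, one_smul]

theorem shiftFilling_fst_eq (m : ℕ) (f : Fin n → Box p d) (a b : Fin n) :
    (shiftFilling m f a).1 = (shiftFilling m f b).1 ↔ (f a).1 = (f b).1 := by
  simp [shiftFilling, Prod.ext_iff]

theorem axial_shiftFilling (m : ℕ) (f : Fin n → Box p d) (a b : Fin n) :
    axial (shiftFilling m f) a b = axial f a b := by
  unfold axial
  simp only [shiftFilling_fst_eq]
  rfl

theorem shiftOp_swapOp (lam : MultiPartition p d n) (m : ℕ) {a b : Fin n}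
    (hab : (a : ℕ) + 1 = b) :
    shiftOp lam m * swapOp lam a b = swapOp lam a b * shiftOp lam m := by
  refine end_ext fun f hf => ?_
  have e1 : shiftFilling m (f ∘ Equiv.swap a b) = shiftFilling m f ∘ Equiv.swap a b := rfl
  rw [Module.End.mul_apply, Module.End.mul_apply, swapOp_vec lam hab, shiftOp_vec m hf,
    swapOp_vec lam hab, map_add, map_smul, map_smul, shiftOp_vec m hf, axial_shiftFilling]
  congr 2
  by_cases hs : IsStd lam (f ∘ Equiv.swap a b)
  · rw [shiftOp_vec m hs, e1]
  · rw [vec_not hs, map_zero, vec_not]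
    intro hs'
    refine hs ⟨hf.inj.comp (Equiv.injective _), (hf.range_comp _).2, fun k l h1 h2 => ?_⟩
    exact hs'.mono k l ((shiftFilling_fst_eq m (f ∘ Equiv.swap a b) k l).2 h1) h2

theorem shiftOp_permRep (lam : MultiPartition p d n) (m : ℕ) (σ : Equiv.Perm (Fin n)) :
    shiftOp lam m * permRep lam σ = permRep lam σ * shiftOp lam m := by
  refine perm_induction (P := fun σ => shiftOp lam m * permRep lam σ =
    permRep lam σ * shiftOp lam m) ?_ ?_ ?_ σ
  · rw [map_one, one_mul, mul_one]
  · intro i h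
    rw [permRep_swap, shiftOp_swapOp lam m rfl]
  · intro σ τ hσ hτ
    rw [map_mul, ← mul_assoc, hσ, mul_assoc, hτ, mul_assoc]

theorem pow_val_sub (d m : ℕ) (i : ZMod p) {z : ℂ} (hz : z ^ (p * d) = 1) :
    z ^ (d * i.val) = z ^ (d * (i - (m : ZMod p)).val) * (z ^ d) ^ m := by
  have h1 : (z ^ d) ^ p = 1 := by rw [← pow_mul, mul_comm, hz]
  have h2 : i.val % p = ((i - (m : ZMod p)).val + m) % p := by
    have : ((i.val : ℕ) : ZMod p) = (((i - (m : ZMod p)).val + m : ℕ) : ZMod p) := by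
      push_cast
      rw [ZMod.natCast_zmod_val, ZMod.natCast_zmod_val, sub_add_cancel]
    exact (ZMod.natCast_eq_natCast_iff' _ _ _).1 this
  rw [pow_mul, pow_mul, ← pow_add, pow_eq_pow_mod _ h1, h2, ← pow_eq_pow_mod _ h1]

theorem shiftOp_torusOp (lam : MultiPartition p d n) (m : ℕ) {θ : Fin n → ℂ}
    (h1 : ∀ i, θ i ^ (p * d) = 1) (h2 : (∏ i, θ i) ^ d = 1) :
    shiftOp lam m * torusOp lam θ = torusOp lam θ * shiftOp lam m := by
  refine end_ext fun f hf => ?_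
  rw [Module.End.mul_apply, Module.End.mul_apply, torusOp_vec, map_smul, shiftOp_vec m hf,
    torusOp_vec]
  congr 1
  have h3 : ∏ k, (θ k ^ d) ^ m = 1 := by
    rw [Finset.prod_pow, Finset.prod_pow, h2, one_pow]
  rw [← mul_one (∏ k, θ k ^ (d * (shiftFilling m f k).1.1.val + _)), ← h3,
    ← Finset.prod_mul_distrib]
  refine Finset.prod_congr rfl fun k _ => ?_
  rw [pow_add, pow_add, pow_val_sub d m _ (h1 k)]
  simp only [shiftFilling]
  ring

end Tableaux

/-! ### The groups `G(r, p, n)` -/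

/-- `w` acts by the monomial matrix with `w e_j = θ (σ j) e_{σ j}`. -/
def IsMonomial {n : ℕ} (w : EuclideanSpace ℂ (Fin n) ≃ₗᵢ[ℂ] EuclideanSpace ℂ (Fin n))
    (θ : Fin n → ℂ) (σ : Equiv.Perm (Fin n)) : Prop :=
  ∀ v i, w v i = θ i * v (σ.symm i)

theorem IsMonomial.ne_zero {n : ℕ} {w : EuclideanSpace ℂ (Fin n) ≃ₗᵢ[ℂ] EuclideanSpace ℂ (Fin n)}
    {θ : Fin n → ℂ} {σ : Equiv.Perm (Fin n)} (h : IsMonomial w θ σ) (i : Fin n) : θ i ≠ 0 := by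
  intro h0
  have := h (w.symm (EuclideanSpace.single i 1)) i
  rw [h0, zero_mul, LinearIsometryEquiv.apply_symm_apply] at this
  simp at this

theorem IsMonomial.unique {n : ℕ} {w : EuclideanSpace ℂ (Fin n) ≃ₗᵢ[ℂ] EuclideanSpace ℂ (Fin n)}
    {θ θ' : Fin n → ℂ} {σ σ' : Equiv.Perm (Fin n)} (h : IsMonomial w θ σ)
    (h' : IsMonomial w θ' σ') : θ = θ' ∧ σ = σ' := by
  have key : ∀ i, σ'.symm i = σ.symm i := by
    intro i
    by_contra hne
    have e := (h (EuclideanSpace.single (σ.symm i) 1) i).symm.trans (h' _ i)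
    simp [hne] at e
    exact h.ne_zero i e
  have hσ : σ = σ' := by
    rw [← Equiv.symm_symm σ, ← Equiv.symm_symm σ']
    exact congrArg Equiv.symm (Equiv.ext fun i => (key i).symm)
  subst hσ
  refine ⟨funext fun i => ?_, rfl⟩
  have e := (h (EuclideanSpace.single (σ.symm i) 1) i).symm.trans (h' _ i)
  simpa using e

theorem IsMonomial.mul {n : ℕ} {w w' : EuclideanSpace ℂ (Fin n) ≃ₗᵢ[ℂ] EuclideanSpace ℂ (Fin n)}
    {θ θ' : Fin n → ℂ} {σ σ' : Equiv.Perm (Fin n)} (h : IsMonomial w θ σ)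
    (h' : IsMonomial w' θ' σ') : IsMonomial (w * w') (fun i => θ i * θ' (σ.symm i)) (σ * σ') := by
  intro v i
  rw [LinearIsometryEquiv.coe_mul, Function.comp_apply, h, h', mul_assoc]; rfl

/-- The group `G(r, p, n)` of unitary transformations of `ℂⁿ` given by monomial matrices whose
nonzero entries are `r`-th roots of unity with product an `(r / p)`-th root of unity. -/
def imprimitiveGroup (r p n : ℕ) :
    Subgroup (EuclideanSpace ℂ (Fin n) ≃ₗᵢ[ℂ] EuclideanSpace ℂ (Fin n)) where
  carrier := {w | ∃ (θ : Fin n → ℂ) (σ : Equiv.Perm (Fin n)),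
    (∀ i, θ i ^ r = 1) ∧ (∏ i, θ i) ^ (r / p) = 1 ∧ IsMonomial w θ σ}
  one_mem' := ⟨fun _ => 1, 1, by simp, by simp, fun v i => (one_mul _).symm⟩
  mul_mem' := by
    rintro w w' ⟨θ, σ, h1, h2, h3⟩ ⟨θ', σ', h1', h2', h3'⟩
    refine ⟨fun i => θ i * θ' (σ.symm i), σ * σ', fun i => ?_, ?_, h3.mul h3'⟩
    · rw [mul_pow, h1, h1', one_mul]
    · rw [Finset.prod_mul_distrib, Equiv.prod_comp σ.symm θ', mul_pow, h2, h2', one_mul]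
  inv_mem' := by
    rintro w ⟨θ, σ, h1, h2, h3⟩
    refine ⟨fun i => (θ (σ i))⁻¹, σ⁻¹, fun i => ?_, ?_, fun v i => ?_⟩
    · rw [inv_pow, h1, inv_one]
    · rw [Finset.prod_inv_distrib, Equiv.prod_comp σ θ, inv_pow, h2, inv_one]
    · have h := h3 (w.symm v) (σ i)
      rw [LinearIsometryEquiv.apply_symm_apply, Equiv.symm_apply_apply] at h
      show w.symm v i = (θ (σ i))⁻¹ * v (σ i)
      rw [h, inv_mul_cancel_left₀ (h3.ne_zero _)]


theorem imprimitiveGroup_le (r p n : ℕ) :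
    imprimitiveGroup r p n ≤ imprimitiveGroup r 1 n := by
  rintro w ⟨θ, σ, h1, _, h3⟩
  refine ⟨θ, σ, h1, ?_, h3⟩
  rw [Nat.div_one, ← Finset.prod_pow]
  exact Finset.prod_eq_one fun i _ => h1 i

instance finite_imprimitiveGroup (r p n : ℕ) [NeZero r] : Finite (imprimitiveGroup r p n) := by
  have hfin : Finite {z : ℂ // z ^ r = 1} := by
    refine ((Polynomial.nthRoots r (1 : ℂ)).toFinset.finite_toSet.subset fun z hz => ?_).to_subtype
    have hz' : z ^ r = 1 := hz
    simpa [Polynomial.mem_nthRoots (NeZero.pos r)] using hz'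
  choose θ σ h1 _ h3 using fun w : imprimitiveGroup r p n => w.2
  refine Finite.of_injective
    (fun w => ((fun i => ⟨θ w i, h1 w i⟩ : Fin n → {z : ℂ // z ^ r = 1}), σ w)) ?_
  intro w w' hww
  obtain ⟨e1, e2⟩ := Prod.ext_iff.1 hww
  refine Subtype.ext (LinearIsometryEquiv.ext fun v => ?_)
  ext i
  rw [h3 w, h3 w']
  have e3 := congrArg Subtype.val (congrFun e1 i)
  simp only at e2 e3
  rw [e2, e3]

theorem exists_isMonomial {r p n : ℕ} (w : imprimitiveGroup r p n) :
    ∃ x : (Fin n → ℂ) × Equiv.Perm (Fin n), IsMonomial w.1 x.1 x.2 := by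
  obtain ⟨θ, σ, _, _, h⟩ := w.2
  exact ⟨(θ, σ), h⟩

section VRep

variable {p d n : ℕ} [NeZero p]

/-- The representation of `G(r, 1, n)`, `r = p d`, on `V(λ)`: the monomial matrix with entries `θ`
and permutation `σ` acts as the diagonal matrix with entries `θ` times the permutation matrix
of `σ`. -/
noncomputable def VRep (lam : MultiPartition p d n) :
    Representation ℂ (imprimitiveGroup (p * d) 1 n) (VMod lam) where
  toFun w := torusOp lam (exists_isMonomial w).choose.1 *
    permRep lam (exists_isMonomial w).choose.2
  map_one' := by
    have h1 : IsMonomial (n := n) 1 (fun _ => 1) 1 := fun v i => (one_mul _).symm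
    obtain ⟨e1, e2⟩ := (exists_isMonomial (1 : imprimitiveGroup (p * d) 1 n)).choose_spec.unique h1
    rw [e1, e2, torusOp_one, map_one, one_mul]
  map_mul' w w' := by
    have h := (exists_isMonomial (w * w')).choose_spec
    obtain ⟨e1, e2⟩ :=
      h.unique ((exists_isMonomial w).choose_spec.mul (exists_isMonomial w').choose_spec)
    rw [e1, e2, torusOp_mul, map_mul, mul_assoc, mul_assoc,
      ← mul_assoc (permRep lam _) (torusOp lam _), permRep_torusOp, mul_assoc]

theorem VRep_apply (lam : MultiPartition p d n) (w : imprimitiveGroup (p * d) 1 n)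
    {θ : Fin n → ℂ} {σ : Equiv.Perm (Fin n)} (h : IsMonomial w.1 θ σ) :
    VRep lam w = torusOp lam θ * permRep lam σ := by
  obtain ⟨e1, e2⟩ := (exists_isMonomial w).choose_spec.unique h
  show torusOp lam (exists_isMonomial w).choose.1 *
    permRep lam (exists_isMonomial w).choose.2 = _
  rw [e1, e2]

/-- The restriction of `V(λ)` to `G(r, p, n)`, `r = p d`. -/
noncomputable def VRes (lam : MultiPartition p d n) :
    Representation ℂ (imprimitiveGroup (p * d) p n) (VMod lam) :=
  (VRep lam).comp (Subgroup.inclusion (imprimitiveGroup_le (p * d) p n))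

/-- The module `V(λ̄, l)` of `G(r, p, n)`: the eigenspace for the eigenvalue `exp(2 π i l / e_λ)` of
`v(T) ↦ v(shift^{p / e_λ} T)` on `V(λ)`. -/
noncomputable def VBar (lam : MultiPartition p d n) (l : ℕ) : Subrepresentation (VRes lam) where
  toSubmodule := Module.End.eigenspace (shiftOp lam (p / eNumber lam))
    (Complex.exp (2 * Real.pi * Complex.I * l / eNumber lam))
  apply_mem_toSubmodule := by
    intro w v hv
    obtain ⟨θ, σ, h1, h2, h3⟩ := w.2
    rw [Nat.mul_div_cancel_left _ (NeZero.pos p)] at h2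
    have hw : VRes lam w = torusOp lam θ * permRep lam σ := VRep_apply lam _ h3
    have hcomm : shiftOp lam (p / eNumber lam) * VRes lam w =
        VRes lam w * shiftOp lam (p / eNumber lam) := by
      rw [hw, ← mul_assoc, shiftOp_torusOp lam _ h1 h2, mul_assoc, shiftOp_permRep, mul_assoc]
    rw [Module.End.mem_eigenspace_iff] at hv ⊢
    rw [← Module.End.mul_apply, hcomm, Module.End.mul_apply, hv, map_smul]

/-- The vector space underlying `V(λ̄, l)`. -/
def VBarMod (lam : MultiPartition p d n) (l : ℕ) : Type := (VBar lam l).toSubmodule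

noncomputable instance (lam : MultiPartition p d n) (l : ℕ) : AddCommGroup (VBarMod lam l) :=
  inferInstanceAs (AddCommGroup (VBar lam l).toSubmodule)

noncomputable instance (lam : MultiPartition p d n) (l : ℕ) : Module ℂ (VBarMod lam l) :=
  inferInstanceAs (Module ℂ (VBar lam l).toSubmodule)

/-- The representation of `G(r, p, n)` on `V(λ̄, l)`. -/
noncomputable def VBarRep (lam : MultiPartition p d n) (l : ℕ) :
    Representation ℂ (imprimitiveGroup (p * d) p n) (VBarMod lam l) :=
  (VBar lam l).toRepresentation

end VRep

/-! ### Rational Cherednik algebras and standard modules -/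

section Cherednik

variable {V : Type*} [NormedAddCommGroup V] [InnerProductSpace ℂ V] [FiniteDimensional ℂ V]

/-- The space of vectors fixed by `g`. -/
def fixedSpace (g : V ≃ₗᵢ[ℂ] V) : Submodule ℂ V where
  carrier := {v | g v = v}
  add_mem' {u v} hu hv := by
    show g (u + v) = u + v
    rw [map_add, show g u = u from hu, show g v = v from hv]
  zero_mem' := map_zero g
  smul_mem' a v hv := by
    show g (a • v) = a • v
    rw [map_smul, show g v = v from hv]

/-- A reflection is a unitary transformation whose fixed space is a hyperplane. -/
def IsReflection (g : V ≃ₗᵢ[ℂ] V) : Prop :=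
  Module.finrank ℂ (fixedSpace g) + 1 = Module.finrank ℂ V

/-- For a reflection `g` with hyperplane `H`, normal vector `v_H` and `α_H = ⟪v_H, ·⟫`, the value
`⟨α_H, y⟩ ⟨x, v_H⟩ / ⟨α_H, v_H⟩`, which is `x` evaluated at the orthogonal projection of `y` to the
line `Hᗮ` spanned by `v_H`. -/
noncomputable def reflCoeff (g : V ≃ₗᵢ[ℂ] V) (x : Module.Dual ℂ V) (y : V) : ℂ :=
  x ((fixedSpace g)ᗮ.starProjection y)

/-- The generators of the Cherednik algebra: `x ∈ V*`, `y ∈ V` and `w ∈ W`. -/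
inductive CherednikGen (W : Subgroup (V ≃ₗᵢ[ℂ] V))
  | x (ξ : Module.Dual ℂ V)
  | y (v : V)
  | w (g : W)

/-- The dual action of `g` on `V*`. -/
def dualAct (g : V ≃ₗᵢ[ℂ] V) (ξ : Module.Dual ℂ V) : Module.Dual ℂ V :=
  ξ ∘ₗ (g⁻¹ : V ≃ₗᵢ[ℂ] V).toLinearEquiv.toLinearMap

open CherednikGen in
open scoped Classical in
/-- The defining relations of the Cherednik algebra: `V*`, `V` are linear subspaces, `W` is a
subgroup of the units, the commutation relations `[x, x'] = 0`, `[y, y'] = 0`, `w x w⁻¹ = w(x)`,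
`w y w⁻¹ = w(y)`, and
`[y, x] = ⟨y, x⟩ + ∑_H (⟨α_H, y⟩ ⟨x, v_H⟩ / ⟨α_H, v_H⟩) γ_H` with `γ_H = ∑_{g ∈ W_H ∖ 1} c_g g`.
The pairs `(H, g)` with `H` a reflection hyperplane and `g ∈ W_H ∖ 1` are the reflections `g ∈ W`,
so the double sum is written as one sum over the reflections of (the finite group) `W`. -/
inductive CherednikRel (W : Subgroup (V ≃ₗᵢ[ℂ] V)) (c : (V ≃ₗᵢ[ℂ] V) → ℂ) :
    FreeAlgebra ℂ (CherednikGen W) → FreeAlgebra ℂ (CherednikGen W) → Prop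
  | x_add (ξ η) : CherednikRel W c (.ι ℂ (x (ξ + η))) (.ι ℂ (x ξ) + .ι ℂ (x η))
  | x_smul (a : ℂ) (ξ) : CherednikRel W c (.ι ℂ (x (a • ξ))) (a • .ι ℂ (x ξ))
  | y_add (u v) : CherednikRel W c (.ι ℂ (y (u + v))) (.ι ℂ (y u) + .ι ℂ (y v))
  | y_smul (a : ℂ) (v) : CherednikRel W c (.ι ℂ (y (a • v))) (a • .ι ℂ (y v))
  | w_one : CherednikRel W c (.ι ℂ (w 1)) 1
  | w_mul (g h : W) : CherednikRel W c (.ι ℂ (w (g * h))) (.ι ℂ (w g) * .ι ℂ (w h))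
  | x_comm (ξ η) : CherednikRel W c (.ι ℂ (x ξ) * .ι ℂ (x η)) (.ι ℂ (x η) * .ι ℂ (x ξ))
  | y_comm (u v) : CherednikRel W c (.ι ℂ (y u) * .ι ℂ (y v)) (.ι ℂ (y v) * .ι ℂ (y u))
  | w_x (g : W) (ξ) : CherednikRel W c (.ι ℂ (w g) * .ι ℂ (x ξ) * .ι ℂ (w g⁻¹))
      (.ι ℂ (x (dualAct g.1 ξ)))
  | w_y (g : W) (v) : CherednikRel W c (.ι ℂ (w g) * .ι ℂ (y v) * .ι ℂ (w g⁻¹))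
      (.ι ℂ (y (g.1 v)))
  | y_x (v) (ξ) : CherednikRel W c (.ι ℂ (y v) * .ι ℂ (x ξ) - .ι ℂ (x ξ) * .ι ℂ (y v))
      (algebraMap ℂ _ (ξ v) +
        ∑ᶠ g : W, (if IsReflection g.1 then c g.1 * reflCoeff g.1 ξ v else 0) • .ι ℂ (w g))

/-- The rational Cherednik algebra `H_c(W)` of a finite group `W` of unitary transformations of `V`;
only the values of `c` at reflections of `W` matter. -/
def CherednikAlgebra (W : Subgroup (V ≃ₗᵢ[ℂ] V)) (c : (V ≃ₗᵢ[ℂ] V) → ℂ) : Type _ :=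
  RingQuot (CherednikRel W c)

namespace CherednikAlgebra

variable (W : Subgroup (V ≃ₗᵢ[ℂ] V)) (c : (V ≃ₗᵢ[ℂ] V) → ℂ)

noncomputable instance : Ring (CherednikAlgebra W c) :=
  inferInstanceAs (Ring (RingQuot (CherednikRel W c)))

noncomputable instance : Algebra ℂ (CherednikAlgebra W c) :=
  inferInstanceAs (Algebra ℂ (RingQuot (CherednikRel W c)))

/-- The quotient map from the free algebra on the generators. -/
noncomputable def mk : FreeAlgebra ℂ (CherednikGen W) →ₐ[ℂ] CherednikAlgebra W c :=
  RingQuot.mkAlgHom ℂ (CherednikRel W c)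

/-- The generators, as elements of `H_c(W)`. -/
noncomputable def gen (a : CherednikGen W) : CherednikAlgebra W c :=
  mk W c (FreeAlgebra.ι ℂ a)

theorem rel {a b : FreeAlgebra ℂ (CherednikGen W)} (h : CherednikRel W c a b) :
    mk W c a = mk W c b :=
  RingQuot.mkAlgHom_rel ℂ h

variable {W}

/-- The generator of a subgroup, as a generator of the whole group. -/
def inclGen {W' : Subgroup (V ≃ₗᵢ[ℂ] V)} (hle : W' ≤ W) : CherednikGen W' → CherednikGen W
  | .x ξ => .x ξ
  | .y v => .y v
  | .w g => .w (Subgroup.inclusion hle g)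

/-- The algebra homomorphism `H_c(W') → H_c(W)` that is the identity on `V*`, `V` and `W'`, for
`W' ≤ W` such that `c` vanishes at the reflections of `W` that are not in `W'`. -/
noncomputable def incl {W' : Subgroup (V ≃ₗᵢ[ℂ] V)} [Finite W] (hle : W' ≤ W)
    (hc : ∀ g ∈ W, IsReflection g → g ∉ W' → c g = 0) :
    CherednikAlgebra W' c →ₐ[ℂ] CherednikAlgebra W c :=
  RingQuot.liftAlgHom ℂ ⟨FreeAlgebra.lift ℂ fun a => gen W c (inclGen hle a), by
    classical
    intro a b hab
    induction hab with
    | x_add ξ η => simpa [gen, inclGen] using rel W c (.x_add ξ η)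
    | x_smul a ξ => simpa [gen, inclGen] using rel W c (.x_smul a ξ)
    | y_add u v => simpa [gen, inclGen] using rel W c (.y_add u v)
    | y_smul a v => simpa [gen, inclGen] using rel W c (.y_smul a v)
    | w_one => simpa [gen, inclGen] using rel W c .w_one
    | w_mul g h => simpa [gen, inclGen] using rel W c (.w_mul (Subgroup.inclusion hle g)
        (Subgroup.inclusion hle h))
    | x_comm ξ η => simpa [gen, inclGen] using rel W c (.x_comm ξ η)
    | y_comm u v => simpa [gen, inclGen] using rel W c (.y_comm u v)
    | w_x g ξ => simpa [gen, inclGen] using rel W c (.w_x (Subgroup.inclusion hle g) ξ)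
    | w_y g v => simpa [gen, inclGen] using rel W c (.w_y (Subgroup.inclusion hle g) v)
    | y_x v ξ =>
      have h := rel W c (.y_x v ξ)
      have : Finite W' := Finite.of_injective _ (Subgroup.inclusion_injective hle)
      have key : ∀ F : W → CherednikAlgebra W c, (∀ g : W, g.1 ∉ W' → F g = 0) →
          ∑ᶠ g : W', F (Subgroup.inclusion hle g) = ∑ᶠ g : W, F g := by
        intro F hF
        rw [← finsum_mem_range (Subgroup.inclusion_injective hle), finsum_mem_def]
        refine finsum_congr fun g => Set.indicator_apply_eq_self.2 fun hg => hF g fun hg' => ?_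
        exact hg ⟨⟨g.1, hg'⟩, rfl⟩
      have h' := key (fun g => (if IsReflection g.1 then c g.1 * reflCoeff g.1 ξ v else 0) •
        gen W c (.w g)) (fun g hg => by
          split_ifs with hr
          · rw [hc g.1 g.2 hr hg, zero_mul, zero_smul]
          · rw [zero_smul])
      simp only [map_sub, map_mul, map_add, AlgHom.commutes, FreeAlgebra.lift_ι_apply] at h ⊢
      rw [map_finsum _ (Set.toFinite _)] at h ⊢
      simp only [map_smul, FreeAlgebra.lift_ι_apply] at h ⊢
      exact h.trans (congrArg _ h'.symm)⟩

theorem incl_gen {W' : Subgroup (V ≃ₗᵢ[ℂ] V)} [Finite W] (hle : W' ≤ W)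
    (hc : ∀ g ∈ W, IsReflection g → g ∉ W' → c g = 0) (a : CherednikGen W') :
    incl c hle hc (gen W' c a) = gen W c (inclGen hle a) := by
  show RingQuot.liftAlgHom ℂ _ (RingQuot.mkAlgHom ℂ _ _) = _
  rw [RingQuot.liftAlgHom_mkAlgHom_apply, FreeAlgebra.lift_ι_apply]

end CherednikAlgebra

variable {S : Type*} [AddCommGroup S] [Module ℂ S]

/-- The submodule of `H_c(W) ⊗ S` generated by the relations of the balanced tensor product
over `ℂ[V*] ⋊ W`, where `W` acts on `S` by `σ` and `V` acts by zero. -/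
noncomputable def standardRel (W : Subgroup (V ≃ₗᵢ[ℂ] V)) (c : (V ≃ₗᵢ[ℂ] V) → ℂ) (σ : Representation ℂ W S) :
    Submodule (CherednikAlgebra W c) (CherednikAlgebra W c ⊗[ℂ] S) :=
  Submodule.span _
    ({t | ∃ h g s, t = (h * CherednikAlgebra.gen W c (.w g)) ⊗ₜ[ℂ] s - h ⊗ₜ[ℂ] (σ g s)} ∪
      {t | ∃ h v s, t = (h * CherednikAlgebra.gen W c (.y v)) ⊗ₜ[ℂ] s})

/-- The standard module `Δ(σ) = H_c(W) ⊗_{ℂ[V*] ⋊ W} σ` (isomorphic to `ℂ[V] ⊗ σ` as a vector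
space), where `V` acts on `σ` by zero. -/
def StandardModule (W : Subgroup (V ≃ₗᵢ[ℂ] V)) (c : (V ≃ₗᵢ[ℂ] V) → ℂ)
    (σ : Representation ℂ W S) : Type _ :=
  (CherednikAlgebra W c ⊗[ℂ] S) ⧸ standardRel W c σ

noncomputable instance (W : Subgroup (V ≃ₗᵢ[ℂ] V)) (c : (V ≃ₗᵢ[ℂ] V) → ℂ)
    (σ : Representation ℂ W S) : AddCommGroup (StandardModule W c σ) :=
  inferInstanceAs (AddCommGroup ((CherednikAlgebra W c ⊗[ℂ] S) ⧸ standardRel W c σ))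

noncomputable instance (W : Subgroup (V ≃ₗᵢ[ℂ] V)) (c : (V ≃ₗᵢ[ℂ] V) → ℂ)
    (σ : Representation ℂ W S) : Module (CherednikAlgebra W c) (StandardModule W c σ) :=
  inferInstanceAs
    (Module (CherednikAlgebra W c) ((CherednikAlgebra W c ⊗[ℂ] S) ⧸ standardRel W c σ))

/-- The restriction of the `B`-module `M` along `φ : A → B` is isomorphic to the `A`-module `N`. -/
def RestrictsTo {A B : Type*} [Ring A] [Algebra ℂ A] [Ring B] [Algebra ℂ B] (φ : A →ₐ[ℂ] B)
    (M : Type*) [AddCommGroup M] [Module B M] (N : Type*) [AddCommGroup N] [Module A N] : Prop :=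
  ∃ f : M ≃+ N, ∀ (a : A) (m : M), f (φ a • m) = a • f m

end Cherednik

end ImprimitiveCherednik

/-!
Let `W' = G(r, p, n)` and `W = G(r, 1, n)`. Since `W` normalizes `W'` and preserves `c`, it acts
on `Δ(σ|W') = ℂ[V] ⊗ σ` diagonally, and this action extends the one of `H_c(W')` to `H_c(W)`,
because `c` vanishes on the reflections outside `W'`. The universal properties of `Δ(σ)` over
`H_c(W)` and of `Δ(σ|W')` over `H_c(W')` then identify the two, so the restriction of `Δ(σ)` is
`Δ(σ|W')` and everything reduces to the decomposition of `V(λ)` under `W'`.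

The power of the shift that fixes `λ` acts on `V(λ)` with order `e_λ` and commutes with `W'`, so its
eigenprojections split `V(λ)` into the `V(λ̄, l)`. For irreducibility, the algebra of operators
generated by `W'` contains the Jucys–Murphy elements, and its elements diagonal in the tableau basis
separate tableaux that are not shifts of each other. Hence a nonzero subrepresentation of `V(λ̄, l)`
contains the eigenprojection of some `v(T)`, and by the seminormal form, which connects all standard
tableaux through admissible transpositions, those of all of them.
-/

namespace ImprimitiveCherednik

section Reflections

variable {V : Type*} [NormedAddCommGroup V] [InnerProductSpace ℂ V]

theorem dualAct_apply (g : V ≃ₗᵢ[ℂ] V) (ξ : Module.Dual ℂ V) (v : V) :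
    dualAct g ξ v = ξ (g⁻¹ v) := rfl

theorem dualAct_mul (g h : V ≃ₗᵢ[ℂ] V) (ξ : Module.Dual ℂ V) :
    dualAct (g * h) ξ = dualAct g (dualAct h ξ) := by
  ext v
  simp only [dualAct_apply, mul_inv_rev, LinearIsometryEquiv.coe_mul, Function.comp_apply]

theorem dualAct_apply_apply (g : V ≃ₗᵢ[ℂ] V) (ξ : Module.Dual ℂ V) (v : V) :
    dualAct g ξ (g v) = ξ v := by
  simp [dualAct_apply]

theorem fixedSpace_conj (w g : V ≃ₗᵢ[ℂ] V) :
    fixedSpace (w * g * w⁻¹) = (fixedSpace g).map (w.toLinearEquiv : V →ₗ[ℂ] V) := by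
  ext v
  rw [Submodule.mem_map_equiv]
  exact w.toLinearEquiv.eq_symm_apply.symm

theorem isReflection_conj (w g : V ≃ₗᵢ[ℂ] V) : IsReflection (w * g * w⁻¹) ↔ IsReflection g := by
  rw [IsReflection, IsReflection, fixedSpace_conj, LinearEquiv.finrank_map_eq]

variable [FiniteDimensional ℂ V]

theorem reflCoeff_conj (w g : V ≃ₗᵢ[ℂ] V) (ξ : Module.Dual ℂ V) (v : V) :
    reflCoeff (w * g * w⁻¹) (dualAct w ξ) (w v) = reflCoeff g ξ v := by
  have starProjection_conj :
      (fixedSpace (w * g * w⁻¹))ᗮ.starProjection (w v) = w ((fixedSpace g)ᗮ.starProjection v) := by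
    simp only [fixedSpace_conj, Submodule.starProjection_orthogonal_val]
    rw [Submodule.starProjection_map_apply, map_sub]
    simp
  rw [reflCoeff, reflCoeff, starProjection_conj, dualAct_apply_apply]

open scoped Classical in
/-- The coefficient of `g` in the commutator `[y, x]` of `H_c(W)`, extended by zero to the elements
`g` that are not reflections. -/
noncomputable def commCoeff (c : (V ≃ₗᵢ[ℂ] V) → ℂ) (g : V ≃ₗᵢ[ℂ] V) (ξ : Module.Dual ℂ V)
    (v : V) : ℂ :=
  if IsReflection g then c g * reflCoeff g ξ v else 0

theorem commCoeff_eq_zero {c : (V ≃ₗᵢ[ℂ] V) → ℂ} {g : V ≃ₗᵢ[ℂ] V} (h : IsReflection g → c g = 0)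
    (ξ : Module.Dual ℂ V) (v : V) : commCoeff c g ξ v = 0 := by
  by_cases hg : IsReflection g
  · simp [commCoeff, h hg]
  · simp [commCoeff, hg]

theorem commCoeff_conj {c : (V ≃ₗᵢ[ℂ] V) → ℂ} {w g : V ≃ₗᵢ[ℂ] V}
    (h : IsReflection g → c (w * g * w⁻¹) = c g) (ξ : Module.Dual ℂ V) (v : V) :
    commCoeff c (w * g * w⁻¹) (dualAct w ξ) (w v) = commCoeff c g ξ v := by
  by_cases hg : IsReflection g
  · simp [commCoeff, isReflection_conj, reflCoeff_conj, hg, h hg]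
  · simp [commCoeff, isReflection_conj, hg]

end Reflections

theorem finsum_inclusion {G M : Type*} [Group G] [AddCommMonoid M] {H K : Subgroup G} (hle : H ≤ K)
    {F : K → M} (hF : ∀ g : K, g.1 ∉ H → F g = 0) :
    ∑ᶠ h : H, F (Subgroup.inclusion hle h) = ∑ᶠ g : K, F g := by
  rw [← finsum_mem_range (Subgroup.inclusion_injective hle), finsum_mem_def]
  refine finsum_congr fun g => Set.indicator_apply_eq_self.2 fun hg => hF g fun hg' => hg ?_
  exact ⟨⟨g.1, hg'⟩, rfl⟩

namespace CherednikAlgebra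

variable {V : Type*} [NormedAddCommGroup V] [InnerProductSpace ℂ V] [FiniteDimensional ℂ V]
  {W W' : Subgroup (V ≃ₗᵢ[ℂ] V)} {c : (V ≃ₗᵢ[ℂ] V) → ℂ}
  {B : Type*} [Ring B] [Algebra ℂ B]

section Generators

variable (W c)

/-- The inclusion of `V*` in `H_c(W)`. -/
noncomputable def x : Module.Dual ℂ V →ₗ[ℂ] CherednikAlgebra W c where
  toFun ξ := gen W c (.x ξ)
  map_add' ξ η := by simpa [gen] using rel W c (.x_add ξ η)
  map_smul' a ξ := by simpa [gen] using rel W c (.x_smul a ξ)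

/-- The inclusion of `V` in `H_c(W)`. -/
noncomputable def y : V →ₗ[ℂ] CherednikAlgebra W c where
  toFun v := gen W c (.y v)
  map_add' u v := by simpa [gen] using rel W c (.y_add u v)
  map_smul' a v := by simpa [gen] using rel W c (.y_smul a v)

/-- The inclusion of `W` in `H_c(W)`. -/
noncomputable def w : W →* CherednikAlgebra W c where
  toFun g := gen W c (.w g)
  map_one' := by simpa [gen] using rel W c .w_one
  map_mul' g h := by simpa [gen] using rel W c (.w_mul g h)

theorem x_commute (ξ η : Module.Dual ℂ V) : Commute (x W c ξ) (x W c η) := by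
  have h := rel W c (.x_comm ξ η)
  rw [map_mul, map_mul] at h
  exact h

theorem y_commute (u v : V) : Commute (y W c u) (y W c v) := by
  have h := rel W c (.y_comm u v)
  rw [map_mul, map_mul] at h
  exact h

theorem w_semiconjBy_x (g : W) (ξ : Module.Dual ℂ V) :
    SemiconjBy (w W c g) (x W c ξ) (x W c (dualAct g.1 ξ)) := by
  have h : w W c g * x W c ξ * w W c g⁻¹ = x W c (dualAct g.1 ξ) := by
    have h := rel W c (.w_x g ξ)
    rw [map_mul, map_mul] at h
    exact h
  rw [SemiconjBy, ← h, mul_assoc _ (w W c g⁻¹), ← map_mul, inv_mul_cancel, map_one, mul_one]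

theorem w_semiconjBy_y (g : W) (v : V) :
    SemiconjBy (w W c g) (y W c v) (y W c (g.1 v)) := by
  have h : w W c g * y W c v * w W c g⁻¹ = y W c (g.1 v) := by
    have h := rel W c (.w_y g v)
    rw [map_mul, map_mul] at h
    exact h
  rw [SemiconjBy, ← h, mul_assoc _ (w W c g⁻¹), ← map_mul, inv_mul_cancel, map_one, mul_one]

theorem y_mul_x_sub [Finite W] (v : V) (ξ : Module.Dual ℂ V) :
    y W c v * x W c ξ - x W c ξ * y W c v =
      algebraMap ℂ _ (ξ v) + ∑ᶠ g : W, commCoeff c g.1 ξ v • w W c g := by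
  have h := rel W c (.y_x v ξ)
  simp only [map_sub, map_mul, map_add, AlgHom.commutes, map_finsum _ (Set.toFinite _),
    map_smul] at h
  exact h

end Generators

@[elab_as_elim]
theorem induction {P : CherednikAlgebra W c → Prop} (algebraMap : ∀ r, P (algebraMap ℂ _ r))
    (x : ∀ ξ, P (x W c ξ)) (y : ∀ v, P (y W c v)) (w : ∀ g, P (w W c g))
    (mul : ∀ a b, P a → P b → P (a * b)) (add : ∀ a b, P a → P b → P (a + b))
    (a : CherednikAlgebra W c) : P a := by
  obtain ⟨b, rfl⟩ : ∃ b, mk W c b = a := RingQuot.mkAlgHom_surjective ℂ (CherednikRel W c) a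
  induction b using FreeAlgebra.induction with
  | grade0 r => simpa only [AlgHom.commutes] using algebraMap r
  | grade1 t => cases t with
    | x ξ => exact x ξ
    | y v => exact y v
    | w g => exact w g
  | mul a b ha hb => simpa only [map_mul] using mul _ _ ha hb
  | add a b ha hb => simpa only [map_add] using add _ _ ha hb

theorem semiconjBy_algHom {f f' : CherednikAlgebra W c →ₐ[ℂ] B} {u : B}
    (hx : ∀ ξ, SemiconjBy u (f (x W c ξ)) (f' (x W c ξ)))
    (hy : ∀ v, SemiconjBy u (f (y W c v)) (f' (y W c v)))
    (hw : ∀ g, SemiconjBy u (f (w W c g)) (f' (w W c g))) (a : CherednikAlgebra W c) :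
    SemiconjBy u (f a) (f' a) := by
  induction a using CherednikAlgebra.induction with
  | algebraMap r => simp only [AlgHom.commutes]; exact (Algebra.commutes r u).symm
  | x ξ => exact hx ξ
  | y v => exact hy v
  | w g => exact hw g
  | mul a b ha hb => simpa only [map_mul] using ha.mul_right hb
  | add a b ha hb => simpa only [map_add] using ha.add_right hb

theorem algHom_ext {f f' : CherednikAlgebra W c →ₐ[ℂ] B} (hx : ∀ ξ, f (x W c ξ) = f' (x W c ξ))
    (hy : ∀ v, f (y W c v) = f' (y W c v)) (hw : ∀ g, f (w W c g) = f' (w W c g)) : f = f' := by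
  refine AlgHom.ext fun a => ?_
  simpa [SemiconjBy] using semiconjBy_algHom (u := (1 : B)) (fun ξ => by simp [SemiconjBy, hx])
    (fun v => by simp [SemiconjBy, hy]) (fun g => by simp [SemiconjBy, hw]) a

variable (W c B) in
/-- Maps from `V*`, `V` and `W` to an algebra `B` that satisfy the defining relations of `H_c(W)`:
the data that determine an algebra homomorphism `H_c(W) → B`. -/
structure Realization where
  x : Module.Dual ℂ V →ₗ[ℂ] B
  y : V →ₗ[ℂ] B
  w : W →* B
  x_commute ξ η : Commute (x ξ) (x η)
  y_commute u v : Commute (y u) (y v)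
  w_semiconjBy_x g ξ : SemiconjBy (w g) (x ξ) (x (dualAct g.1 ξ))
  w_semiconjBy_y g v : SemiconjBy (w g) (y v) (y (g.1 v))
  y_mul_x_sub v ξ : y v * x ξ - x ξ * y v =
    algebraMap ℂ B (ξ v) + ∑ᶠ g : W, commCoeff c g.1 ξ v • w g

namespace Realization

/-- The values of a realization at the generators of `H_c(W)`. -/
def onGen (R : Realization W c B) : CherednikGen W → B
  | .x ξ => R.x ξ
  | .y v => R.y v
  | .w g => R.w g

theorem lift_onGen_eq [Finite W] (R : Realization W c B) {a b : FreeAlgebra ℂ (CherednikGen W)}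
    (h : CherednikRel W c a b) : FreeAlgebra.lift ℂ R.onGen a = FreeAlgebra.lift ℂ R.onGen b := by
  have w_mul_mul_inv (g : W) {s t : B} (hst : SemiconjBy (R.w g) s t) :
      R.w g * s * R.w g⁻¹ = t := by
    rw [hst.eq, mul_assoc, ← map_mul, mul_inv_cancel, map_one, mul_one]
  induction h with
  | x_add ξ η => simp [onGen]
  | x_smul a ξ => simp [onGen]
  | y_add u v => simp [onGen]
  | y_smul a v => simp [onGen]
  | w_one => simp [onGen]
  | w_mul g h => simp [onGen]
  | x_comm ξ η => simpa [onGen] using (R.x_commute ξ η).eq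
  | y_comm u v => simpa [onGen] using (R.y_commute u v).eq
  | w_x g ξ => simpa [onGen] using w_mul_mul_inv g (R.w_semiconjBy_x g ξ)
  | w_y g v => simpa [onGen] using w_mul_mul_inv g (R.w_semiconjBy_y g v)
  | y_x v ξ =>
    simp only [map_sub, map_mul, map_add, AlgHom.commutes, map_finsum _ (Set.toFinite _),
      map_smul, FreeAlgebra.lift_ι_apply]
    exact R.y_mul_x_sub v ξ

/-- The algebra homomorphism from `H_c(W)` defined by a realization. -/
noncomputable def lift [Finite W] (R : Realization W c B) : CherednikAlgebra W c →ₐ[ℂ] B :=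
  RingQuot.liftAlgHom ℂ ⟨FreeAlgebra.lift ℂ R.onGen, fun {_ _} h => R.lift_onGen_eq h⟩

theorem lift_gen [Finite W] (R : Realization W c B) (t : CherednikGen W) :
    R.lift (gen W c t) = R.onGen t := by
  change RingQuot.liftAlgHom ℂ _ (RingQuot.mkAlgHom ℂ _ _) = _
  rw [RingQuot.liftAlgHom_mkAlgHom_apply, FreeAlgebra.lift_ι_apply]

theorem lift_x [Finite W] (R : Realization W c B) (ξ : Module.Dual ℂ V) :
    R.lift (CherednikAlgebra.x W c ξ) = R.x ξ :=
  R.lift_gen (.x ξ)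

theorem lift_y [Finite W] (R : Realization W c B) (v : V) :
    R.lift (CherednikAlgebra.y W c v) = R.y v :=
  R.lift_gen (.y v)

theorem lift_w [Finite W] (R : Realization W c B) (g : W) :
    R.lift (CherednikAlgebra.w W c g) = R.w g :=
  R.lift_gen (.w g)

end Realization

section Inclusion

variable [Finite W] (hle : W' ≤ W) (hc : ∀ g ∈ W, IsReflection g → g ∉ W' → c g = 0)

theorem incl_x (ξ : Module.Dual ℂ V) : incl c hle hc (x W' c ξ) = x W c ξ :=
  incl_gen c hle hc (.x ξ)

theorem incl_y (v : V) : incl c hle hc (y W' c v) = y W c v :=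
  incl_gen c hle hc (.y v)

theorem incl_w (g : W') : incl c hle hc (w W' c g) = w W c (Subgroup.inclusion hle g) :=
  incl_gen c hle hc (.w g)

include hc in
theorem exists_extension (L : CherednikAlgebra W' c →ₐ[ℂ] B) (T : W →* B)
    (hT : ∀ h, T (Subgroup.inclusion hle h) = L (w W' c h))
    (hx : ∀ g ξ, SemiconjBy (T g) (L (x W' c ξ)) (L (x W' c (dualAct g.1 ξ))))
    (hy : ∀ g v, SemiconjBy (T g) (L (y W' c v)) (L (y W' c (g.1 v)))) :
    ∃ Φ : CherednikAlgebra W c →ₐ[ℂ] B, Φ.comp (incl c hle hc) = L ∧ ∀ g, Φ (w W c g) = T g := by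
  have : Finite W' := Finite.of_injective _ (Subgroup.inclusion_injective hle)
  let R : Realization W c B :=
    { x := L.toLinearMap ∘ₗ x W' c
      y := L.toLinearMap ∘ₗ y W' c
      w := T
      x_commute := fun ξ η => (x_commute W' c ξ η).map L
      y_commute := fun u v => (y_commute W' c u v).map L
      w_semiconjBy_x := hx
      w_semiconjBy_y := hy
      y_mul_x_sub := fun v ξ => by
        have vanish (g : W) (hg : g.1 ∉ W') : commCoeff c g.1 ξ v • T g = 0 := by
          rw [commCoeff_eq_zero (fun hr => hc g.1 g.2 hr hg), zero_smul]
        rw [← finsum_inclusion hle vanish]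
        have h := congrArg L (y_mul_x_sub W' c v ξ)
        simp only [map_sub, map_mul, map_add, AlgHom.commutes, map_finsum _ (Set.toFinite _),
          map_smul, ← hT] at h
        exact h }
  refine ⟨R.lift, algHom_ext (fun ξ => ?_) (fun v => ?_) fun h => ?_, R.lift_w⟩
  · exact (congrArg R.lift (incl_x hle hc ξ)).trans (R.lift_x ξ)
  · exact (congrArg R.lift (incl_y hle hc v)).trans (R.lift_y v)
  · exact (congrArg R.lift (incl_w hle hc h)).trans ((R.lift_w _).trans (hT h))

end Inclusion

section Conjugation

variable [Finite W'] {g : V ≃ₗᵢ[ℂ] V} (hg : g ∈ Subgroup.normalizer (W' : Set (V ≃ₗᵢ[ℂ] V)))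
  (hinv : ∀ h ∈ W', IsReflection h → c (g * h * g⁻¹) = c h)

/-- Conjugation by an element `g` of the normalizer of `W'` that leaves `c` invariant, as an algebra
endomorphism of `H_c(W')`. -/
noncomputable def conj : CherednikAlgebra W' c →ₐ[ℂ] CherednikAlgebra W' c :=
  Realization.lift
    { x := x W' c ∘ₗ (g⁻¹ : V ≃ₗᵢ[ℂ] V).toLinearEquiv.toLinearMap.dualMap
      y := y W' c ∘ₗ g.toLinearEquiv.toLinearMap
      w := (w W' c).comp (W'.normalizerMonoidHom ⟨g, hg⟩).toMonoidHom
      x_commute := fun ξ η => x_commute W' c _ _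
      y_commute := fun u v => y_commute W' c _ _
      w_semiconjBy_x := fun h ξ => by
        have key := w_semiconjBy_x W' c (W'.normalizerMonoidHom ⟨g, hg⟩ h) (dualAct g ξ)
        rw [← dualAct_mul] at key
        change SemiconjBy _ _ (x W' c (dualAct (g * h.1 * g⁻¹ * g) ξ)) at key
        rw [inv_mul_cancel_right, dualAct_mul] at key
        exact key
      w_semiconjBy_y := fun h v => by
        have key := w_semiconjBy_y W' c (W'.normalizerMonoidHom ⟨g, hg⟩ h) (g v)
        change SemiconjBy _ _ (y W' c ((g * h.1 * g⁻¹ * g) v)) at key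
        rw [inv_mul_cancel_right] at key
        exact key
      y_mul_x_sub := fun v ξ => by
        have key := y_mul_x_sub W' c (g v) (dualAct g ξ)
        rw [dualAct_apply_apply,
          ← finsum_comp_equiv (W'.normalizerMonoidHom ⟨g, hg⟩).toEquiv] at key
        refine key.trans (congrArg _ (finsum_congr fun h => ?_))
        exact congrArg (· • _) (commCoeff_conj (hinv h.1 h.2) ξ v) }

theorem conj_x (ξ : Module.Dual ℂ V) : conj hg hinv (x W' c ξ) = x W' c (dualAct g ξ) :=
  Realization.lift_x _ ξ

theorem conj_y (v : V) : conj hg hinv (y W' c v) = y W' c (g v) :=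
  Realization.lift_y _ v

theorem conj_w (h : W') :
    conj hg hinv (w W' c h) = w W' c (W'.normalizerMonoidHom ⟨g, hg⟩ h) :=
  Realization.lift_w _ h

theorem w_semiconjBy_conj (g : W') (hg : g.1 ∈ Subgroup.normalizer (W' : Set (V ≃ₗᵢ[ℂ] V)))
    (hinv : ∀ h ∈ W', IsReflection h → c (g.1 * h * g.1⁻¹) = c h) (a : CherednikAlgebra W' c) :
    SemiconjBy (w W' c g) a (conj hg hinv a) := by
  refine semiconjBy_algHom (f := AlgHom.id ℂ _) (fun ξ => ?_) (fun v => ?_) (fun h => ?_) a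
  · simpa only [conj_x, AlgHom.id_apply] using w_semiconjBy_x W' c g ξ
  · simpa only [conj_y, AlgHom.id_apply] using w_semiconjBy_y W' c g v
  · rw [conj_w]
    refine SemiconjBy.map (a := g) (x := h) ?_ (w W' c)
    exact Subtype.ext (inv_mul_cancel_right _ _).symm

theorem w_semiconjBy_incl_conj [Finite W] (hle : W' ≤ W)
    (hc : ∀ g ∈ W, IsReflection g → g ∉ W' → c g = 0) (g : W)
    (hg : g.1 ∈ Subgroup.normalizer (W' : Set (V ≃ₗᵢ[ℂ] V)))
    (hinv : ∀ h ∈ W', IsReflection h → c (g.1 * h * g.1⁻¹) = c h) (a : CherednikAlgebra W' c) :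
    SemiconjBy (w W c g) (incl c hle hc a) (incl c hle hc (conj hg hinv a)) := by
  refine semiconjBy_algHom (f' := (incl c hle hc).comp (conj hg hinv))
    (fun ξ => ?_) (fun v => ?_) (fun h => ?_) a
  · simpa only [AlgHom.comp_apply, conj_x, incl_x] using w_semiconjBy_x W c g ξ
  · simpa only [AlgHom.comp_apply, conj_y, incl_y] using w_semiconjBy_y W c g v
  · simp only [AlgHom.comp_apply, conj_w, incl_w]
    refine SemiconjBy.map (a := g) (x := Subgroup.inclusion hle h) ?_ (w W c)
    exact Subtype.ext (inv_mul_cancel_right _ _).symm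

end Conjugation

end CherednikAlgebra

theorem nonempty_linearEquiv_directSum {R M ι : Type*} [Semiring R] [AddCommMonoid M] [Module R M]
    [Fintype ι] {N : ι → Type*} [∀ i, AddCommMonoid (N i)] [∀ i, Module R (N i)]
    (inc : ∀ i, N i →ₗ[R] M) (pr : ∀ i, M →ₗ[R] N i)
    (pr_inc_self : ∀ i, pr i ∘ₗ inc i = LinearMap.id)
    (pr_inc_ne : ∀ i j, i ≠ j → pr i ∘ₗ inc j = 0)
    (sum_inc_pr : ∑ i, inc i ∘ₗ pr i = LinearMap.id) : Nonempty (M ≃ₗ[R] ⨁ i, N i) := by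
  classical
  refine ⟨LinearEquiv.ofLinearMap (∑ i, DirectSum.lof R ι N i ∘ₗ pr i)
    (DirectSum.toModule R ι M inc)
    (DirectSum.linearMap_ext R fun j => ?_) ?_⟩
  · ext m : 1
    have h (i : ι) : pr i (inc j m) = if h : i = j then h ▸ m else 0 := by
      split_ifs with hij
      · subst hij
        exact LinearMap.congr_fun (pr_inc_self i) m
      · exact LinearMap.congr_fun (pr_inc_ne i j hij) m
    simp only [LinearMap.comp_apply, LinearMap.sum_apply, DirectSum.toModule_lof, h,
      LinearMap.id_apply]
    rw [Finset.sum_eq_single j (fun i _ hij => by rw [dif_neg hij, map_zero])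
      fun hj => absurd (Finset.mem_univ j) hj, dif_pos rfl]
  · ext m
    have h := LinearMap.congr_fun sum_inc_pr m
    simp only [LinearMap.sum_apply, LinearMap.comp_apply] at h
    simp only [LinearMap.comp_apply, LinearMap.sum_apply, map_sum, DirectSum.toModule_lof, h]

namespace StandardModule

open CherednikAlgebra Representation

variable {V : Type*} [NormedAddCommGroup V] [InnerProductSpace ℂ V] [FiniteDimensional ℂ V]
  {W : Subgroup (V ≃ₗᵢ[ℂ] V)} {c : (V ≃ₗᵢ[ℂ] V) → ℂ}
  {S S' : Type*} [AddCommGroup S] [Module ℂ S] [AddCommGroup S'] [Module ℂ S']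
  {σ : Representation ℂ W S} {σ' : Representation ℂ W S'}

noncomputable instance : Module ℂ (StandardModule W c σ) :=
  inferInstanceAs (Module ℂ ((CherednikAlgebra W c ⊗[ℂ] S) ⧸ standardRel W c σ))

instance : IsScalarTower ℂ (CherednikAlgebra W c) (StandardModule W c σ) :=
  inferInstanceAs
    (IsScalarTower ℂ (CherednikAlgebra W c) ((CherednikAlgebra W c ⊗[ℂ] S) ⧸ standardRel W c σ))

variable (c σ) in
/-- The canonical map `σ → Δ(σ)`. -/
noncomputable def of : S →ₗ[ℂ] StandardModule W c σ :=
  (standardRel W c σ).mkQ.restrictScalars ℂ ∘ₗ TensorProduct.mk ℂ (CherednikAlgebra W c) S 1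

theorem mkQ_tmul (h : CherednikAlgebra W c) (s : S) :
    (standardRel W c σ).mkQ (h ⊗ₜ s) = h • of c σ s := by
  change _ = h • (standardRel W c σ).mkQ (1 ⊗ₜ s)
  rw [← map_smul, TensorProduct.smul_tmul', smul_eq_mul, mul_one]

theorem w_smul_of (g : W) (s : S) : w W c g • of c σ s = of c σ (σ g s) := by
  rw [← mkQ_tmul]
  exact (Submodule.Quotient.eq _).2 (Submodule.subset_span (Or.inl ⟨1, g, s, by rw [one_mul]; rfl⟩))

theorem y_smul_of (v : V) (s : S) : y W c v • of c σ s = 0 := by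
  rw [← mkQ_tmul]
  exact (Submodule.Quotient.mk_eq_zero _).2
    (Submodule.subset_span (Or.inr ⟨1, v, s, by rw [one_mul]; rfl⟩))

@[elab_as_elim]
theorem induction {P : StandardModule W c σ → Prop}
    (smul_of : ∀ (h : CherednikAlgebra W c) s, P (h • of c σ s))
    (add : ∀ a b, P a → P b → P (a + b)) (m : StandardModule W c σ) : P m := by
  obtain ⟨t, rfl⟩ := (standardRel W c σ).mkQ_surjective m
  induction t using TensorProduct.induction_on with
  | zero => rw [← TensorProduct.zero_tmul _ (0 : S), mkQ_tmul]; exact smul_of 0 0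
  | tmul h s => simpa only [mkQ_tmul] using smul_of h s
  | add a b ha hb => exact add _ _ ha hb

theorem hom_ext {B M : Type*} [Semiring B] [AddCommMonoid M] [Module B M]
    {φ : CherednikAlgebra W c →+* B} {f f' : StandardModule W c σ →ₛₗ[φ] M}
    (h : ∀ s, f (of c σ s) = f' (of c σ s)) : f = f' := by
  ext m
  induction m using StandardModule.induction with
  | smul_of a s => rw [map_smulₛₗ, map_smulₛₗ, h]
  | add a b ha hb => rw [map_add, map_add, ha, hb]

section Lift

variable {B : Type*} [Ring B] [Algebra ℂ B] {M : Type*} [AddCommGroup M] [Module ℂ M] [Module B M]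
  [IsScalarTower ℂ B M] (φ : CherednikAlgebra W c →ₐ[ℂ] B) (f : S →ₗ[ℂ] M)

/-- The map `h ⊗ s ↦ φ h • f s`, which induces `StandardModule.lift` on the quotient `Δ(σ)` of
`H_c(W) ⊗ σ`. -/
noncomputable def liftTensor :
    CherednikAlgebra W c ⊗[ℂ] S →ₛₗ[(φ : CherednikAlgebra W c →+* B)] M where
  __ := TensorProduct.lift (((Algebra.lsmul ℂ ℂ M).toLinearMap ∘ₗ φ.toLinearMap).compl₂ f)
  map_smul' h t := by
    induction t using TensorProduct.induction_on with
    | zero => simp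
    | tmul k s => simp [TensorProduct.smul_tmul']
    | add a b ha hb => simp_all [smul_add]

theorem liftTensor_tmul (h : CherednikAlgebra W c) (s : S) :
    liftTensor φ f (h ⊗ₜ s) = φ h • f s := rfl

variable (hw : ∀ g s, φ (w W c g) • f s = f (σ g s)) (hy : ∀ v s, φ (y W c v) • f s = 0)

/-- The universal property of `Δ(σ)`, for maps that are semilinear along `φ`. -/
noncomputable def lift : StandardModule W c σ →ₛₗ[(φ : CherednikAlgebra W c →+* B)] M :=
  (standardRel W c σ).liftQ (liftTensor φ f) <| by
    refine Submodule.span_le.2 ?_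
    rintro t (⟨h, g, s, rfl⟩ | ⟨h, v, s, rfl⟩)
    · change liftTensor φ f ((h * w W c g) ⊗ₜ s - h ⊗ₜ σ g s) = 0
      rw [map_sub, liftTensor_tmul, liftTensor_tmul, map_mul, mul_smul, hw, sub_self]
    · change liftTensor φ f ((h * y W c v) ⊗ₜ s) = 0
      rw [liftTensor_tmul, map_mul, mul_smul, hy, smul_zero]

theorem lift_of (s : S) : lift φ f hw hy (of c σ s) = f s := by
  change liftTensor φ f (1 ⊗ₜ s) = f s
  rw [liftTensor_tmul, map_one, one_smul]

end Lift

variable (c) in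
/-- The map `Δ(σ) → Δ(σ')` induced by an intertwining map. -/
noncomputable def map (f : IntertwiningMap σ σ') :
    StandardModule W c σ →ₗ[CherednikAlgebra W c] StandardModule W c σ' :=
  lift (AlgHom.id ℂ _) (of c σ' ∘ₗ f.toLinearMap)
    (fun g s => by
      simpa using (w_smul_of g (f s)).trans (congrArg _ (f.isIntertwining _ _ g s).symm))
    (fun v s => y_smul_of v (f s))

theorem map_of (f : IntertwiningMap σ σ') (s : S) : map c f (of c σ s) = of c σ' (f s) :=
  lift_of ..

theorem nonempty_linearEquiv (e : Representation.Equiv σ σ') :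
    Nonempty (StandardModule W c σ ≃ₗ[CherednikAlgebra W c] StandardModule W c σ') :=
  ⟨LinearEquiv.ofLinearMap (map c e.toIntertwiningMap) (map c e.symm.toIntertwiningMap)
    (hom_ext fun s => by simp [map_of]) (hom_ext fun s => by simp [map_of])⟩

theorem nonempty_linearEquiv_directSum {ι : Type*} [Fintype ι] {T : ι → Type*}
    [∀ i, AddCommGroup (T i)] [∀ i, Module ℂ (T i)] {τ : ∀ i, Representation ℂ W (T i)}
    (inc : ∀ i, IntertwiningMap (τ i) σ) (pr : ∀ i, IntertwiningMap σ (τ i))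
    (pr_inc_self : ∀ i t, pr i (inc i t) = t) (pr_inc_ne : ∀ i j, i ≠ j → ∀ t, pr i (inc j t) = 0)
    (sum_inc_pr : ∀ s, ∑ i, inc i (pr i s) = s) :
    Nonempty (StandardModule W c σ ≃ₗ[CherednikAlgebra W c] ⨁ i, StandardModule W c (τ i)) :=
  ImprimitiveCherednik.nonempty_linearEquiv_directSum (fun i => map c (inc i))
    (fun i => map c (pr i)) (fun i => hom_ext fun t => by simp [map_of, pr_inc_self])
    (fun i j hij => hom_ext fun t => by simp [map_of, pr_inc_ne i j hij])
    (hom_ext fun s => by simp [map_of, ← map_sum, sum_inc_pr])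

end StandardModule

section Restriction

open CherednikAlgebra

variable {V : Type*} [NormedAddCommGroup V] [InnerProductSpace ℂ V] [FiniteDimensional ℂ V]
  {W W' : Subgroup (V ≃ₗᵢ[ℂ] V)} {c : (V ≃ₗᵢ[ℂ] V) → ℂ}
  {S : Type*} [AddCommGroup S] [Module ℂ S] (σ : Representation ℂ W S) (hle : W' ≤ W)

namespace StandardModule

section Twist

variable [Finite W'] (hn : W ≤ Subgroup.normalizer (W' : Set (V ≃ₗᵢ[ℂ] V)))
  (hinv : ∀ g ∈ W, ∀ h ∈ W', IsReflection h → c (g * h * g⁻¹) = c h)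

/-- The action `h ⊗ s ↦ g h g⁻¹ ⊗ g s` of `g ∈ W` on the standard module of the restriction of `σ`
to a normal subgroup `W'`, as a map that is semilinear along conjugation by `g`. -/
noncomputable def twist (g : W) : StandardModule W' c (σ.comp (Subgroup.inclusion hle)) →ₛₗ[
    (conj (hn g.2) (hinv g.1 g.2) : CherednikAlgebra W' c →+* CherednikAlgebra W' c)]
    StandardModule W' c (σ.comp (Subgroup.inclusion hle)) :=
  lift _ (of c _ ∘ₗ σ g)
    (fun h s => by
      rw [conj_w, LinearMap.comp_apply, w_smul_of]
      change of c _ ((σ _ * σ _) s) = of c _ ((σ _ * σ _) s)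
      rw [← map_mul, ← map_mul]
      exact congrArg (fun k => of c _ (σ k s)) (Subtype.ext (inv_mul_cancel_right _ _)))
    (fun v s => by rw [conj_y]; exact y_smul_of _ _)

theorem twist_of (g : W) (s : S) : twist σ hle hn hinv g (of c _ s) = of c _ (σ g s) :=
  lift_of ..

theorem twist_mul_apply (g h : W) (m : StandardModule W' c (σ.comp (Subgroup.inclusion hle))) :
    twist σ hle hn hinv (g * h) m = twist σ hle hn hinv g (twist σ hle hn hinv h m) := by
  have conj_mul : conj (hn (g * h).2) (hinv (g * h).1 (g * h).2) =
      (conj (hn g.2) (hinv g.1 g.2)).comp (conj (hn h.2) (hinv h.1 h.2)) := by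
    refine algHom_ext (fun ξ => ?_) (fun v => ?_) fun k => ?_
    · simp only [AlgHom.comp_apply, conj_x, Subgroup.coe_mul, dualAct_mul]
    · simp only [AlgHom.comp_apply, conj_y]
      rfl
    · simp only [AlgHom.comp_apply, conj_w]
      congr 1
  induction m using StandardModule.induction with
  | smul_of a s =>
    simp only [map_smulₛₗ, twist_of, conj_mul, map_mul]
    rfl
  | add a b ha hb => rw [map_add, map_add, map_add, ha, hb]

theorem twist_inclusion_apply (g : W')
    (m : StandardModule W' c (σ.comp (Subgroup.inclusion hle))) :
    twist σ hle hn hinv (Subgroup.inclusion hle g) m = w W' c g • m := by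
  induction m using StandardModule.induction with
  | smul_of a s =>
    rw [map_smulₛₗ, twist_of, ← mul_smul,
      (w_semiconjBy_conj g (hn (hle g.2)) (hinv g (hle g.2)) a).eq, mul_smul, w_smul_of]
    rfl
  | add a b ha hb => rw [map_add, smul_add, ha, hb]

/-- The action of `W` by `StandardModule.twist`. -/
noncomputable def twistHom :
    W →* Module.End ℂ (StandardModule W' c (σ.comp (Subgroup.inclusion hle))) where
  toFun g :=
    { twist σ hle hn hinv g with
      map_smul' := fun a m => by
        rw [← algebraMap_smul (CherednikAlgebra W' c) a m]
        refine ((twist σ hle hn hinv g).map_smulₛₗ _ _).trans ?_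
        rw [RingHom.coe_coe, AlgHom.commutes, algebraMap_smul]
        rfl }
  map_one' := LinearMap.ext fun m => by
    have h := twist_inclusion_apply σ hle hn hinv 1 m
    rwa [map_one, map_one, one_smul] at h
  map_mul' g h := LinearMap.ext fun m => twist_mul_apply σ hle hn hinv g h m

end Twist

variable [Finite W] (hc : ∀ g ∈ W, IsReflection g → g ∉ W' → c g = 0)

/-- The canonical map from the standard module of the restriction of `σ` to `Δ(σ)`. -/
noncomputable def ofRes : StandardModule W' c (σ.comp (Subgroup.inclusion hle)) →ₛₗ[
    (incl c hle hc : CherednikAlgebra W' c →+* CherednikAlgebra W c)] StandardModule W c σ :=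
  lift (incl c hle hc) (of c σ) (fun g s => by rw [incl_w]; exact w_smul_of _ s)
    (fun v s => by rw [incl_y]; exact y_smul_of v s)

theorem ofRes_of (s : S) : ofRes σ hle hc (of c _ s) = of c σ s :=
  lift_of ..

theorem ofRes_twist [Finite W'] (hn : W ≤ Subgroup.normalizer (W' : Set (V ≃ₗᵢ[ℂ] V)))
    (hinv : ∀ g ∈ W, ∀ h ∈ W', IsReflection h → c (g * h * g⁻¹) = c h) (g : W)
    (m : StandardModule W' c (σ.comp (Subgroup.inclusion hle))) :
    ofRes σ hle hc (twist σ hle hn hinv g m) = w W c g • ofRes σ hle hc m := by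
  induction m using StandardModule.induction with
  | smul_of a s =>
    simp only [map_smulₛₗ, twist_of, ofRes_of, ← w_smul_of, ← mul_smul, RingHom.coe_coe]
    rw [(w_semiconjBy_incl_conj hle hc g (hn g.2) (hinv g g.2) a).eq]
  | add a b ha hb => rw [map_add, map_add, map_add, smul_add, ha, hb]

theorem ofRes_apply_of_extends
    {Φ : CherednikAlgebra W c →ₐ[ℂ] Module.End ℂ
      (StandardModule W' c (σ.comp (Subgroup.inclusion hle)))}
    (hincl : ∀ a m, Φ (incl c hle hc a) m = a • m)
    (hw : ∀ g m, ofRes σ hle hc (Φ (w W c g) m) = w W c g • ofRes σ hle hc m)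
    (a : CherednikAlgebra W c) (m : StandardModule W' c (σ.comp (Subgroup.inclusion hle))) :
    ofRes σ hle hc (Φ a m) = a • ofRes σ hle hc m := by
  have of_incl (b : CherednikAlgebra W' c) (m) :
      ofRes σ hle hc (Φ (incl c hle hc b) m) = incl c hle hc b • ofRes σ hle hc m := by
    rw [hincl, map_smulₛₗ, RingHom.coe_coe]
  induction a using CherednikAlgebra.induction generalizing m with
  | algebraMap r => rw [← (incl c hle hc).commutes r, of_incl]
  | x ξ => rw [← incl_x hle hc, of_incl]
  | y v => rw [← incl_y hle hc, of_incl]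
  | w g => exact hw g m
  | mul a b ha hb => rw [map_mul, Module.End.mul_apply, ha, hb, mul_smul]
  | add a b ha hb => rw [map_add, LinearMap.add_apply, map_add, ha, hb, add_smul]

end StandardModule

open StandardModule

theorem restrictsTo_standardModule [Finite W]
    (hn : W ≤ Subgroup.normalizer (W' : Set (V ≃ₗᵢ[ℂ] V)))
    (hc : ∀ g ∈ W, IsReflection g → g ∉ W' → c g = 0)
    (hinv : ∀ g ∈ W, ∀ h ∈ W', IsReflection h → c (g * h * g⁻¹) = c h) :
    RestrictsTo (incl c hle hc) (StandardModule W c σ)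
      (StandardModule W' c (σ.comp (Subgroup.inclusion hle))) := by
  have : Finite W' := Finite.of_injective _ (Subgroup.inclusion_injective hle)
  obtain ⟨Φ, Φ_comp_incl, Φ_w⟩ := exists_extension hle hc
    (Algebra.lsmul ℂ ℂ (StandardModule W' c (σ.comp (Subgroup.inclusion hle))))
    (twistHom σ hle hn hinv)
    (fun h => LinearMap.ext fun m => twist_inclusion_apply σ hle hn hinv h m)
    (fun g ξ => LinearMap.ext fun m =>
      ((twist σ hle hn hinv g).map_smulₛₗ _ m).trans (congrArg (· • _) (conj_x ..)))
    (fun g v => LinearMap.ext fun m =>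
      ((twist σ hle hn hinv g).map_smulₛₗ _ m).trans (congrArg (· • _) (conj_y ..)))
  have Φ_incl (a m) : Φ (incl c hle hc a) m = a • m :=
    LinearMap.congr_fun (AlgHom.congr_fun Φ_comp_incl a) m
  have ofRes_Φ := ofRes_apply_of_extends σ hle hc Φ_incl fun g m => by
    rw [Φ_w]; exact ofRes_twist σ hle hc hn hinv g m
  let toRes := lift (σ := σ) Φ (of c (σ.comp (Subgroup.inclusion hle)))
      (fun g s => by rw [Φ_w]; exact twist_of σ hle hn hinv g s)
      (fun v s => by rw [← incl_y hle hc]; exact (Φ_incl _ _).trans (y_smul_of v s))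
  have toRes_of (s) : toRes (of c σ s) = of c _ s := lift_of ..
  refine ⟨toRes.toAddMonoidHom.toAddEquiv (ofRes σ hle hc).toAddMonoidHom
    (AddMonoidHom.ext fun m => ?_) (AddMonoidHom.ext fun m => ?_), fun a m => ?_⟩
  · change ofRes σ hle hc (toRes m) = m
    induction m using StandardModule.induction with
    | smul_of a s => rw [map_smulₛₗ, toRes_of]; exact (ofRes_Φ _ _).trans (by rw [ofRes_of])
    | add a b ha hb => rw [map_add, map_add, ha, hb]
  · change toRes (ofRes σ hle hc m) = m
    induction m using StandardModule.induction with
    | smul_of a s =>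
      rw [map_smulₛₗ, ofRes_of, map_smulₛₗ, toRes_of]
      exact Φ_incl a _
    | add a b ha hb => rw [map_add, map_add, ha, hb]
  · exact (toRes.map_smulₛₗ _ m).trans (Φ_incl a _)

end Restriction

theorem RestrictsTo.trans_linearEquiv {A B : Type*} [Ring A] [Algebra ℂ A] [Ring B] [Algebra ℂ B]
    {φ : A →ₐ[ℂ] B} {M N N' : Type*} [AddCommGroup M] [Module B M] [AddCommGroup N] [Module A N]
    [AddCommGroup N'] [Module A N'] (h : RestrictsTo φ M N) (e : N ≃ₗ[A] N') :
    RestrictsTo φ M N' := by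
  obtain ⟨f, hf⟩ := h
  exact ⟨f.trans e.toAddEquiv, fun a m => (congrArg e (hf a m)).trans (e.map_smul a _)⟩

section TableauCombinatorics

variable {p d n : ℕ} [NeZero p] {lam mu : MultiPartition p d n}

theorem MultiPartition.exists_equiv_boxes (lam : MultiPartition p d n) :
    Nonempty (Fin n ≃ {b : Box p d // b.2 ∈ (lam.shape b.1.1 b.1.2).cells}) := by
  have hcard : Fintype.card (Σ ij : ZMod p × Fin d, (lam.shape ij.1 ij.2).cells) = n := by
    simp only [Fintype.card_sigma, Fintype.card_coe, Fintype.sum_prod_type]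
    exact lam.card_eq
  exact ⟨(Fintype.equivFinOfCardEq hcard).symm.trans
    (Equiv.subtypeProdEquivSigmaSubtype
      fun (ij : ZMod p × Fin d) x => x ∈ (lam.shape ij.1 ij.2).cells).symm⟩

/- Numbering the cells by increasing `row + column` gives a standard tableau. -/
theorem exists_isStd (lam : MultiPartition p d n) : ∃ f, IsStd lam f := by
  obtain ⟨e⟩ := lam.exists_equiv_boxes
  let rank : Fin n → ℕ := fun k => (e k).1.2.1 + (e k).1.2.2
  let s := Tuple.sort rank
  let f : Fin n → Box p d := fun k => (e (s k)).1
  have hinj : Function.Injective f := Subtype.val_injective.comp (e.injective.comp s.injective)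
  refine ⟨f, hinj, fun b => ⟨?_, fun hb => ?_⟩, fun k l hkl hle => ?_⟩
  · rintro ⟨k, rfl⟩
    exact (YoungDiagram.mem_cells _).1 (e (s k)).2
  · exact ⟨s.symm (e.symm ⟨b, (YoungDiagram.mem_cells _).2 hb⟩), by
      simp only [f, Equiv.apply_symm_apply]⟩
  · by_contra hlt
    rw [not_le] at hlt
    have hrank : (f l).2.1 + (f l).2.2 ≤ (f k).2.1 + (f k).2.2 := Tuple.monotone_sort rank hlt.le
    rw [Prod.le_def] at hle
    exact hlt.ne (hinj (Prod.ext hkl.symm (Prod.ext (by omega) (by omega))))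

theorem IsStd.exists_perm {f g : Fin n → Box p d} (hf : IsStd lam f) (hg : IsStd lam g) :
    ∃ σ : Equiv.Perm (Fin n), f = g ∘ σ := by
  choose s hs using fun k => (hg.range_iff (f k)).2 ((hf.range_iff _).1 ⟨k, rfl⟩)
  have hinj : Function.Injective s := fun a b hab => hf.inj (by rw [← hs, ← hs, hab])
  exact ⟨Equiv.ofBijective s (Finite.injective_iff_bijective.1 hinj), funext fun k => (hs k).symm⟩

instance (lam : MultiPartition p d n) : Finite (StdTableau lam) := by
  obtain ⟨g, hg⟩ := exists_isStd lam
  choose σ hσ using fun T : StdTableau lam => T.2.exists_perm hg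
  exact Finite.of_injective σ fun T T' h => Subtype.ext (by rw [hσ T, hσ T', h])

theorem IsStd.comp_swap_of_descent {g : Fin n → Box p d} (hg : IsStd lam g)
    {σ : Equiv.Perm (Fin n)} (hσ : IsStd lam (g ∘ σ)) {a b : Fin n} (hab : (a : ℕ) + 1 = b)
    (hdesc : σ b < σ a) : IsStd lam ((g ∘ σ) ∘ Equiv.swap a b) := by
  obtain ⟨hinj, hrange⟩ := hσ.range_comp (Equiv.swap a b)
  refine ⟨hinj, hrange, fun k l hkl hle => ?_⟩
  have hswap := hσ.mono _ _ hkl hle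
  have hval := hg.mono _ _ hkl hle
  by_contra hlt
  obtain ⟨rfl, rfl⟩ : l = a ∧ k = b := by
    simp only [Fin.le_def, swap_val, Fin.ext_iff] at *
    split_ifs at hswap <;> omega
  rw [Equiv.swap_apply_left, Equiv.swap_apply_right] at hval
  exact absurd hdesc (not_lt.2 hval)

theorem perm_eq_one_of_no_descent {σ : Equiv.Perm (Fin n)}
    (h : ∀ a b : Fin n, (a : ℕ) + 1 = b → σ a ≤ σ b) : σ = 1 := by
  cases n with
  | zero => exact Subsingleton.elim _ _
  | succ n =>
    have hmono : StrictMono σ :=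
      (Fin.monotone_iff_le_succ.2 fun i => h i.castSucc i.succ rfl).strictMono_of_injective
        σ.injective
    refine DFunLike.coe_injective ((hmono.range_inj strictMono_id).1 ?_)
    rw [σ.surjective.range_eq, Set.range_id]

/- Sort `f = g ∘ σ` into `g`: undoing a descent of `σ` decreases `σ` lexicographically. -/
theorem IsStd.swap_induction {P : (Fin n → Box p d) → Prop} {f g : Fin n → Box p d}
    (hf : IsStd lam f) (hP : P f)
    (hstep : ∀ (f : Fin n → Box p d) (a b : Fin n), (a : ℕ) + 1 = b → IsStd lam f →
      IsStd lam (f ∘ Equiv.swap a b) → P f → P (f ∘ Equiv.swap a b))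
    (hg : IsStd lam g) : P g := by
  obtain ⟨σ, rfl⟩ := hf.exists_perm hg
  induction hx : toLex (σ : Fin n → Fin n) using WellFoundedLT.induction generalizing σ with
  | ind x ih =>
    subst hx
    by_cases hdesc : ∃ a b : Fin n, (a : ℕ) + 1 = b ∧ σ b < σ a
    · obtain ⟨a, b, hab, hlt⟩ := hdesc
      have hstd := hg.comp_swap_of_descent hf hab hlt
      have hP' := hstep _ a b hab hf hstd hP
      rw [Function.comp_assoc, ← Equiv.Perm.coe_mul] at hstd hP'
      exact ih _ (Pi.lex_desc (Fin.le_def.2 (by omega)) hlt) (σ * Equiv.swap a b) hstd hP' rfl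
    · push Not at hdesc
      obtain rfl := perm_eq_one_of_no_descent hdesc
      exact hP

theorem IsStd.eq_at_of_eq_below {f g : Fin n → Box p d} (hf : IsStd lam f) (hg : IsStd mu g)
    {k : Fin n} (hbelow : ∀ l < k, f l = g l) (hdiag : (f k).1 = (g k).1)
    (hle : (f k).2 ≤ (g k).2) : f k = g k := by
  obtain ⟨m, hm, hmk⟩ := hg.exists_le k _ hle
  rcases hmk.lt_or_eq with h | rfl
  · rw [← hbelow m h] at hm
    exact absurd (hf.inj (hm.trans (Prod.ext hdiag.symm rfl))) h.ne
  · rw [hm, ← hdiag]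

theorem IsStd.eq_of_content {f g : Fin n → Box p d} (hf : IsStd lam f) (hg : IsStd mu g)
    (hdiag : ∀ k, (f k).1 = (g k).1) (hcontent : ∀ k, content f k = content g k) : f = g := by
  funext k
  induction k using WellFoundedLT.induction with
  | ind k ih =>
    have hc := hcontent k
    simp only [content] at hc
    rcases le_total (f k).2.1 (g k).2.1 with h | h
    · exact hf.eq_at_of_eq_below hg ih (hdiag k) (Prod.le_def.2 ⟨h, by omega⟩)
    · exact (hg.eq_at_of_eq_below hf (fun l hl => (ih l hl).symm) (hdiag k).symm
        (Prod.le_def.2 ⟨h, by omega⟩)).symm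

theorem IsStd.shape_unique {f : Fin n → Box p d} (hf : IsStd lam f) (hg : IsStd mu f) :
    lam = mu := by
  ext i j x
  rw [YoungDiagram.mem_cells, YoungDiagram.mem_cells]
  exact (hf.range_iff ((i, j), x)).symm.trans (hg.range_iff ((i, j), x))

theorem IsStd.axial_sq_ne_one {f : Fin n → Box p d} (hf : IsStd lam f) {a b : Fin n}
    (hab : (a : ℕ) + 1 = b) (hs : IsStd lam (f ∘ Equiv.swap a b)) : axial f a b ^ 2 ≠ 1 := by
  intro h
  by_cases hc : (f a).1 = (f b).1
  · rw [axial, if_pos hc, inv_pow, inv_eq_one] at h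
    have hd : content f b - content f a = 1 ∨ content f b - content f a = -1 :=
      sq_eq_one_iff.1 (by exact_mod_cast h)
    have hnle : ¬ (f a).2 ≤ (f b).2 := fun hle => by
      have := hs.mono b a (by simpa using hc) (by simpa using hle)
      rw [Fin.le_def] at this
      omega
    have hnge : ¬ (f b).2 ≤ (f a).2 := fun hle => by
      have := hf.mono b a hc.symm hle
      rw [Fin.le_def] at this
      omega
    rw [Prod.le_def] at hnle hnge
    simp only [content] at hd
    omega
  · rw [axial, if_neg hc] at h
    norm_num at h

end TableauCombinatorics

section Shift

variable {p d n : ℕ}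

theorem shiftFilling_shiftFilling (m m' : ℕ) (f : Fin n → Box p d) :
    shiftFilling m (shiftFilling m' f) = shiftFilling (m + m') f := by
  funext k
  simp only [shiftFilling, Nat.cast_add, sub_sub, add_comm]

theorem shiftFilling_of_dvd {m : ℕ} (h : p ∣ m) (f : Fin n → Box p d) : shiftFilling m f = f := by
  funext k
  simp [shiftFilling, (ZMod.natCast_eq_zero_iff m p).2 h]

theorem shiftFilling_eq_self_iff [NeZero n] {m : ℕ} {f : Fin n → Box p d} :
    shiftFilling m f = f ↔ p ∣ m := by
  refine ⟨fun h => ?_, fun h => shiftFilling_of_dvd h f⟩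
  have hfst : (f 0).1.1 - (m : ZMod p) = (f 0).1.1 := congrArg (fun x => x.1.1) (congrFun h 0)
  rwa [sub_eq_self, ZMod.natCast_eq_zero_iff] at hfst

variable [NeZero p] {lam mu : MultiPartition p d n}

theorem shift_iterate_shape (lam : MultiPartition p d n) (m : ℕ) (i : ZMod p) (j : Fin d) :
    (MultiPartition.shift^[m] lam).shape i j = lam.shape (i + m) j := by
  induction m generalizing i with
  | zero => simp
  | succ m ih =>
    rw [Function.iterate_succ_apply']
    change (MultiPartition.shift^[m] lam).shape (i + 1) j = _
    rw [ih, Nat.cast_succ, add_right_comm, add_assoc]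

theorem shift_iterate_self (lam : MultiPartition p d n) : MultiPartition.shift^[p] lam = lam :=
  MultiPartition.ext (funext fun i => funext fun j => by
    rw [shift_iterate_shape, CharP.cast_eq_zero, add_zero])

/-- The permutation of the boxes underlying the `m`-fold shift of fillings. -/
def boxShift (p d m : ℕ) : Equiv.Perm (Box p d) :=
  ((Equiv.subRight (m : ZMod p)).prodCongr (Equiv.refl _)).prodCongr (Equiv.refl _)

theorem isStd_shiftFilling_iff (m : ℕ) {f : Fin n → Box p d} :
    IsStd (MultiPartition.shift^[m] lam) (shiftFilling m f) ↔ IsStd lam f := by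
  have hinj : Function.Injective (shiftFilling m f) ↔ Function.Injective f :=
    (boxShift p d m).comp_injective f
  have hrange : (∀ b : Box p d, (∃ k, shiftFilling m f k = b) ↔
        b.2 ∈ (MultiPartition.shift^[m] lam).shape b.1.1 b.1.2) ↔
      ∀ b : Box p d, (∃ k, f k = b) ↔ b.2 ∈ lam.shape b.1.1 b.1.2 := by
    rw [← (boxShift p d m).forall_congr_right]
    refine forall_congr' fun b => ?_
    rw [shift_iterate_shape]
    simp only [boxShift, shiftFilling, Equiv.prodCongr_apply, Prod.map, Equiv.subRight_apply,
      Equiv.refl_apply, sub_add_cancel, Prod.ext_iff, sub_left_inj]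
  have hmono : (∀ k l, (shiftFilling m f k).1 = (shiftFilling m f l).1 →
        (shiftFilling m f k).2 ≤ (shiftFilling m f l).2 → k ≤ l) ↔
      ∀ k l, (f k).1 = (f l).1 → (f k).2 ≤ (f l).2 → k ≤ l := by
    simp only [shiftFilling_fst_eq]
    rfl
  exact ⟨fun h => ⟨hinj.1 h.inj, hrange.1 h.range_iff, hmono.1 h.mono⟩,
    fun h => ⟨hinj.2 h.inj, hrange.2 h.range_iff, hmono.2 h.mono⟩⟩

/-- The length of the cyclic equivalence class of `λ`. -/
noncomputable def orbitLength (lam : MultiPartition p d n) : ℕ :=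
  Function.minimalPeriod MultiPartition.shift lam

theorem shift_iterate_eq_self_iff (lam : MultiPartition p d n) (m : ℕ) :
    MultiPartition.shift^[m] lam = lam ↔ orbitLength lam ∣ m :=
  Function.isPeriodicPt_iff_minimalPeriod_dvd

theorem orbitLength_dvd (lam : MultiPartition p d n) : orbitLength lam ∣ p :=
  (shift_iterate_eq_self_iff lam p).1 (shift_iterate_self lam)

theorem orbitLength_pos (lam : MultiPartition p d n) : 0 < orbitLength lam :=
  Nat.pos_of_dvd_of_pos (orbitLength_dvd lam) (NeZero.pos p)

theorem CyclicEquiv.orbitLength_eq (h : CyclicEquiv lam mu) : orbitLength mu = orbitLength lam := by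
  obtain ⟨k, rfl⟩ := h
  exact Function.minimalPeriod_apply_iterate ⟨p, NeZero.pos p, shift_iterate_self lam⟩ k

theorem ncard_cyclicEquiv (lam : MultiPartition p d n) :
    {mu | CyclicEquiv lam mu}.ncard = orbitLength lam := by
  have himage : {mu | CyclicEquiv lam mu} =
      (fun k => MultiPartition.shift^[k] lam) '' Set.Iio (orbitLength lam) := by
    ext mu
    constructor
    · rintro ⟨k, rfl⟩
      exact ⟨k % orbitLength lam, Nat.mod_lt _ (orbitLength_pos lam),
        Function.iterate_mod_minimalPeriod_eq⟩
    · rintro ⟨k, _, rfl⟩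
      exact ⟨k, rfl⟩
  rw [himage, orbitLength, Function.iterate_injOn_Iio_minimalPeriod.ncard_image, ← Finset.coe_Iio,
    Set.ncard_coe_finset, Nat.card_Iio]

theorem eNumber_mul (lam : MultiPartition p d n) : eNumber lam * orbitLength lam = p := by
  rw [eNumber, ncard_cyclicEquiv, Nat.div_mul_cancel (orbitLength_dvd lam)]

instance (lam : MultiPartition p d n) : NeZero (eNumber lam) :=
  ⟨fun h => NeZero.ne p (by rw [← eNumber_mul lam, h, zero_mul])⟩

theorem div_eNumber (lam : MultiPartition p d n) : p / eNumber lam = orbitLength lam :=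
  Nat.div_eq_of_eq_mul_right (NeZero.pos _) (eNumber_mul lam).symm

theorem CyclicEquiv.eNumber_eq (h : CyclicEquiv lam mu) : eNumber mu = eNumber lam :=
  Nat.eq_of_mul_eq_mul_right (orbitLength_pos lam)
    ((congrArg (eNumber mu * ·) h.orbitLength_eq.symm).trans
      ((eNumber_mul mu).trans (eNumber_mul lam).symm))

end Shift

section EigenProjection

variable {K M : Type*} [Field K] [AddCommGroup M] [Module K M]

/-- For an operator `A` with `A ^ e = 1`, the projection to the eigenspace for the eigenvalue `ω`,
an `e`-th root of unity. -/
noncomputable def eigenProj (A : Module.End K M) (e : ℕ) (ω : K) : Module.End K M :=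
  (e : K)⁻¹ • ∑ j ∈ Finset.range e, (ω⁻¹ • A) ^ j

variable {A : Module.End K M} {e : ℕ} {ω : K}

theorem commute_eigenProj {B : Module.End K M} (h : Commute B A) : Commute B (eigenProj A e ω) :=
  (Commute.sum_right _ _ _ fun j _ => (h.smul_right _).pow_right j).smul_right _

theorem mul_eigenProj (hA : A ^ e = 1) (hω : ω ^ e = 1) (he : e ≠ 0) :
    A * eigenProj A e ω = ω • eigenProj A e ω := by
  have hω0 : ω ≠ 0 := fun h => by simp [h, he] at hω
  have hfix : (ω⁻¹ • A) * ∑ j ∈ Finset.range e, (ω⁻¹ • A) ^ j =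
      ∑ j ∈ Finset.range e, (ω⁻¹ • A) ^ j := by
    have hgeom := mul_geom_sum (ω⁻¹ • A) e
    rwa [smul_pow, inv_pow, hω, hA, inv_one, one_smul, sub_self, sub_mul, one_mul,
      sub_eq_zero] at hgeom
  rw [smul_mul_assoc, inv_smul_eq_iff₀ hω0] at hfix
  rw [eigenProj, mul_smul_comm, hfix, smul_comm]

theorem eigenProj_apply_of_eq_smul {v : M} (hv : A v = ω • v) (hω : ω ≠ 0) (he : (e : K) ≠ 0) :
    eigenProj A e ω v = v := by
  have hfix : (ω⁻¹ • A) v = v := by rw [LinearMap.smul_apply, hv, inv_smul_smul₀ hω]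
  have hpow : ∀ j : ℕ, ((ω⁻¹ • A) ^ j) v = v := fun j => by
    rw [Module.End.pow_apply]
    exact Function.iterate_fixed hfix j
  rw [eigenProj, LinearMap.smul_apply, LinearMap.sum_apply]
  simp only [hpow]
  rw [Finset.sum_const, Finset.card_range, ← Nat.cast_smul_eq_nsmul K, inv_smul_smul₀ he]

theorem eigenProj_apply_of_eq_smul_ne {ω' : K} {v : M} (hv : A v = ω' • v) (hne : ω ≠ ω')
    (hA : A ^ e = 1) (hω : ω ^ e = 1) (he : e ≠ 0) : eigenProj A e ω v = 0 := by
  have h : ω' • eigenProj A e ω v = ω • eigenProj A e ω v :=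
    calc ω' • eigenProj A e ω v = (eigenProj A e ω * A) v := by
          rw [Module.End.mul_apply, hv, map_smul]
      _ = (A * eigenProj A e ω) v := by rw [(commute_eigenProj (Commute.refl A)).eq]
      _ = ω • eigenProj A e ω v := by rw [mul_eigenProj hA hω he, LinearMap.smul_apply]
  by_contra hP
  exact hne (smul_left_injective K hP h).symm

theorem sum_eigenProj {ζ : K} (hζ : IsPrimitiveRoot ζ e) (he : (e : K) ≠ 0) (t : ℕ) :
    ∑ l ∈ Finset.range e, eigenProj A e (ζ ^ (l + t)) = 1 := by
  have hterm : ∀ j l, ((ζ ^ (l + t))⁻¹ • A) ^ j = (ζ⁻¹ ^ j) ^ l • ζ⁻¹ ^ (t * j) • A ^ j := by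
    intro j l
    rw [smul_pow, smul_smul, ← inv_pow, ← pow_mul, ← pow_mul, ← pow_add]
    ring_nf
  have hgeom : ∀ j ∈ Finset.range e, j ≠ 0 → ∑ l ∈ Finset.range e, (ζ⁻¹ ^ j) ^ l = 0 := by
    intro j hj hj0
    rw [geom_sum_eq (hζ.inv.pow_ne_one_of_pos_of_lt hj0 (Finset.mem_range.1 hj)), ← pow_mul,
      mul_comm, pow_mul, hζ.inv.pow_eq_one, one_pow, sub_self, zero_div]
  simp only [eigenProj, ← Finset.smul_sum, hterm]
  rw [Finset.sum_comm, Finset.sum_eq_single 0]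
  · simp only [pow_zero, one_pow, mul_zero, one_smul, Finset.sum_const, Finset.card_range]
    rw [← Nat.cast_smul_eq_nsmul K, inv_smul_smul₀ he]
  · intro j hj hj0
    rw [← Finset.sum_smul, hgeom j hj hj0, zero_smul]
  · intro h
    simp_all

end EigenProjection

section FunctionAlgebra

variable {K X : Type*} [Field K] [Finite X] (D : Subalgebra K (X → K))

theorem exists_mem_subalgebra_eq_one (x : X) :
    ∃ ψ ∈ D, ψ x = 1 ∧ ∀ z, (∃ φ ∈ D, φ x ≠ φ z) → ψ z = 0 := by
  classical
  have := Fintype.ofFinite X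
  have hone : ∀ z, ∃ ψ ∈ D, ψ x = 1 ∧ ((∃ φ ∈ D, φ x ≠ φ z) → ψ z = 0) := by
    intro z
    by_cases hsep : ∃ φ ∈ D, φ x ≠ φ z
    · obtain ⟨φ, hφ, hne⟩ := hsep
      refine ⟨(φ x - φ z)⁻¹ • (φ - algebraMap K (X → K) (φ z)),
        D.smul_mem (D.sub_mem hφ (D.algebraMap_mem _)) _, ?_, fun _ => ?_⟩
      · exact inv_mul_cancel₀ (sub_ne_zero.2 hne)
      · simp
    · exact ⟨1, D.one_mem, rfl, fun h => absurd h hsep⟩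
  choose ψ hψ hψx hψz using hone
  refine ⟨∏ z, ψ z, D.prod_mem fun z _ => hψ z, ?_, fun z hz => ?_⟩
  · rw [Finset.prod_apply, Finset.prod_eq_one fun z _ => hψx z]
  · rw [Finset.prod_apply, Finset.prod_eq_zero (f := fun c => ψ c z) (Finset.mem_univ z) (hψz z hz)]

theorem mem_subalgebra_of_separated {g : X → K}
    (hg : ∀ x y, (∀ φ ∈ D, φ x = φ y) → g x = g y) : g ∈ D := by
  classical
  let R : Setoid X := ⟨fun x y => ∀ φ ∈ D, φ x = φ y, fun _ _ _ => rfl,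
    fun h φ hφ => (h φ hφ).symm, fun h h' φ hφ => (h φ hφ).trans (h' φ hφ)⟩
  have := Fintype.ofFinite (Quotient R)
  choose δ hδ hδ_self hδ_sep using exists_mem_subalgebra_eq_one D
  have hsum : g = ∑ q : Quotient R, g q.out • δ q.out := by
    funext y
    have hy : ∀ φ ∈ D, φ (⟦y⟧ : Quotient R).out = φ y := Quotient.mk_out (s := R) y
    rw [Finset.sum_apply, Finset.sum_eq_single (⟦y⟧ : Quotient R)]
    · rw [Pi.smul_apply, ← hy _ (hδ _), hδ_self, hg _ _ hy, smul_eq_mul, mul_one]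
    · intro q _ hq
      have hsep : ∃ φ ∈ D, φ q.out ≠ φ y := by
        by_contra! h
        exact hq (q.out_eq.symm.trans (Quotient.sound h))
      rw [Pi.smul_apply, hδ_sep _ _ hsep, smul_zero]
    · exact fun h => absurd (Finset.mem_univ _) h
  rw [hsum]
  exact D.sum_mem fun q _ => D.smul_mem (hδ _) _

end FunctionAlgebra

theorem exists_isometry_isMonomial {n : ℕ} {θ : Fin n → ℂ} (hθ : ∀ i, ‖θ i‖ = 1)
    (σ : Equiv.Perm (Fin n)) :
    ∃ w : EuclideanSpace ℂ (Fin n) ≃ₗᵢ[ℂ] EuclideanSpace ℂ (Fin n), IsMonomial w θ σ := by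
  have hθ0 : ∀ i, θ i ≠ 0 := fun i => norm_ne_zero_iff.1 (by rw [hθ]; exact one_ne_zero)
  let scale (i : Fin n) : ℂ ≃ₗᵢ[ℂ] ℂ :=
    { LinearEquiv.smulOfNeZero ℂ ℂ (θ i) (hθ0 i) with
      norm_map' := fun z => (norm_smul (θ i) z).trans (by rw [hθ, one_mul]) }
  exact ⟨(LinearIsometryEquiv.piLpCongrLeft 2 ℂ ℂ σ).trans
    (LinearIsometryEquiv.piLpCongrRight 2 scale), fun v i => rfl⟩

section Weights

variable {p d n : ℕ}

/-- The exponent with which the `k`-th entry of a diagonal matrix acts on `v(f)`. -/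
def weight (f : Fin n → Box p d) (k : Fin n) : ℕ := d * (f k).1.1.val + ((f k).1.2 : ℕ)

theorem weight_mod (f : Fin n → Box p d) (k : Fin n) : weight f k % d = (f k).1.2 := by
  rw [weight, Nat.mul_add_mod, Nat.mod_eq_of_lt (f k).1.2.isLt]

variable [NeZero p] {lam : MultiPartition p d n}

theorem weight_lt (f : Fin n → Box p d) (k : Fin n) : weight f k < p * d :=
  calc weight f k < d * (f k).1.1.val + d := Nat.add_lt_add_left (f k).1.2.isLt _
    _ = d * ((f k).1.1.val + 1) := (Nat.mul_succ _ _).symm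
    _ ≤ d * p := Nat.mul_le_mul_left d (ZMod.val_lt (f k).1.1)
    _ = p * d := mul_comm _ _

theorem weight_eq_iff {f : Fin n → Box p d} {a b : Fin n} :
    weight f a = weight f b ↔ (f a).1 = (f b).1 := by
  refine ⟨fun h => ?_, fun h => by rw [weight, weight, h]⟩
  have hsnd : (f a).1.2 = (f b).1.2 := by
    rw [Fin.ext_iff, ← weight_mod, h, weight_mod]
  rw [weight, weight, hsnd, Nat.add_right_cancel_iff] at h
  exact Prod.ext (ZMod.val_injective p (Nat.eq_of_mul_eq_mul_left (f b).1.2.pos h)) hsnd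

theorem IsStd.content_zero {f : Fin n → Box p d} (hf : IsStd lam f) (hn : 0 < n) :
    content f ⟨0, hn⟩ = 0 := by
  obtain ⟨m, hm, hm0⟩ := hf.exists_le ⟨0, hn⟩ (0, 0) ⟨Nat.zero_le _, Nat.zero_le _⟩
  obtain rfl : m = ⟨0, hn⟩ := le_antisymm hm0 (Nat.zero_le m.1)
  have hcorner : (f ⟨0, hn⟩).2 = (0, 0) := congrArg Prod.snd hm
  simp [content, hcorner]

theorem IsStd.axial_mul_content_sub {f : Fin n → Box p d} (hf : IsStd lam f) {a b : Fin n}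
    (hab : (a : ℕ) + 1 = b) :
    axial f a b * ((content f b : ℂ) - content f a) = if (f a).1 = (f b).1 then 1 else 0 := by
  unfold axial
  split_ifs with h
  · rw [← Int.cast_sub]
    refine inv_mul_cancel₀ (Int.cast_ne_zero.2 (sub_ne_zero.2 fun heq => ?_))
    have := hf.content_lt (Fin.lt_def.2 (by omega)) h heq.symm
    omega
  · rw [zero_mul]

end Weights

section GroupOperators

variable {p d n : ℕ} [NeZero p] {lam : MultiPartition p d n}

theorem VRes_apply (w : imprimitiveGroup (p * d) p n) {θ : Fin n → ℂ} {σ : Equiv.Perm (Fin n)}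
    (h : IsMonomial w.1 θ σ) : VRes lam w = torusOp lam θ * permRep lam σ :=
  VRep_apply lam _ h

/-- The algebra of operators on `V(λ)` generated by `G(r, p, n)`. -/
noncomputable def groupOperators (lam : MultiPartition p d n) :
    Subalgebra ℂ (Module.End ℂ (VMod lam)) :=
  Algebra.adjoin ℂ (Set.range (VRes lam))

theorem apply_mem_of_mem_groupOperators (X : Subrepresentation (VRes lam))
    {B : Module.End ℂ (VMod lam)} (hB : B ∈ groupOperators lam) :
    ∀ v ∈ X.toSubmodule, B v ∈ X.toSubmodule := by
  induction hB using Algebra.adjoin_induction with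
  | mem _ hw =>
    obtain ⟨w, rfl⟩ := hw
    exact X.apply_mem_toSubmodule w
  | algebraMap a =>
    intro v hv
    rw [Module.algebraMap_end_apply]
    exact X.toSubmodule.smul_mem a hv
  | add _ _ _ _ hB hC => exact fun v hv => X.toSubmodule.add_mem (hB v hv) (hC v hv)
  | mul _ _ _ _ hB hC => exact fun v hv => hB _ (hC v hv)

theorem torusOp_mem_groupOperators [NeZero d] {θ : Fin n → ℂ} (hθ : θ ^ (p * d) = 1)
    (hprod : (∏ i, θ i) ^ d = 1) : torusOp lam θ ∈ groupOperators lam := by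
  have hroot : ∀ i, θ i ^ (p * d) = 1 := congrFun hθ
  obtain ⟨w, hw⟩ := exists_isometry_isMonomial
    (fun i => Complex.norm_eq_one_of_pow_eq_one (hroot i) (NeZero.ne _)) 1
  have hmem : w ∈ imprimitiveGroup (p * d) p n :=
    ⟨θ, 1, hroot, by rwa [Nat.mul_div_cancel_left _ (NeZero.pos p)], hw⟩
  have h := VRes_apply (lam := lam) ⟨w, hmem⟩ hw
  rw [map_one, mul_one] at h
  exact h ▸ Algebra.subset_adjoin ⟨_, rfl⟩

theorem swapOp_mem_groupOperators {a b : Fin n} (hab : (a : ℕ) + 1 = b) :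
    swapOp lam a b ∈ groupOperators lam := by
  obtain ⟨w, hw⟩ := exists_isometry_isMonomial (fun _ => norm_one) (Equiv.swap a b)
  have hmem : w ∈ imprimitiveGroup (p * d) p n :=
    ⟨fun _ => 1, Equiv.swap a b, by simp, by simp, hw⟩
  have h := VRes_apply (lam := lam) ⟨w, hmem⟩ hw
  obtain ⟨a, ha⟩ := a
  obtain ⟨b, hb⟩ := b
  obtain rfl : a + 1 = b := hab
  rw [torusOp_one, one_mul, permRep_swap lam a hb] at h
  exact h ▸ Algebra.subset_adjoin ⟨_, rfl⟩

/-- The algebra homomorphism that sends `φ` to the operator `v(T) ↦ φ(T) v(T)`. -/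
noncomputable def diagOp (lam : MultiPartition p d n) :
    (StdTableau lam → ℂ) →ₐ[ℂ] Module.End ℂ (VMod lam) where
  toFun φ := Finsupp.linearCombination ℂ fun T => φ T • Finsupp.single T 1
  map_one' := by ext T : 2; simp
  map_mul' φ ψ := by ext T : 2; simp [mul_comm]
  map_zero' := by ext T : 2; simp
  map_add' φ ψ := by ext T : 2; simp
  commutes' a := by ext T : 2; simp

theorem diagOp_single (φ : StdTableau lam → ℂ) (T : StdTableau lam) (a : ℂ) :
    diagOp lam φ (Finsupp.single T a) = φ T • Finsupp.single T a := by
  change Finsupp.linearCombination ℂ (fun T => φ T • Finsupp.single T 1) _ = _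
  rw [Finsupp.linearCombination_single, smul_comm, Finsupp.smul_single_one]

theorem diagOp_vec (φ : (Fin n → Box p d) → ℂ) (f : Fin n → Box p d) :
    diagOp lam (fun T => φ T.1) (vec lam f) = φ f • vec lam f := by
  by_cases hf : IsStd lam f
  · rw [vec_std (⟨f, hf⟩ : StdTableau lam), diagOp_single]
  · rw [vec_not hf, map_zero, smul_zero]

theorem diagOp_apply (φ : StdTableau lam → ℂ) (v : VMod lam) (T : StdTableau lam) :
    diagOp lam φ v T = φ T * v T := by
  induction v using Finsupp.induction_linear with
  | zero => rw [map_zero, Finsupp.zero_apply, mul_zero]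
  | add v w hv hw => rw [map_add, Finsupp.add_apply, hv, hw, Finsupp.add_apply, mul_add]
  | single S a =>
    rw [diagOp_single, Finsupp.smul_apply, smul_eq_mul]
    obtain rfl | h := eq_or_ne S T
    · rfl
    · rw [Finsupp.single_eq_of_ne h.symm, mul_zero, mul_zero]

/-- The functions `φ` on the standard tableaux for which the operator `v(T) ↦ φ(T) v(T)` is in the
algebra generated by `G(r, p, n)`. -/
noncomputable def diagonals (lam : MultiPartition p d n) : Subalgebra ℂ (StdTableau lam → ℂ) :=
  (groupOperators lam).comap (diagOp lam)

theorem mem_diagonals_of_vec {φ : (Fin n → Box p d) → ℂ} {B : Module.End ℂ (VMod lam)}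
    (hB : B ∈ groupOperators lam)
    (h : ∀ f, IsStd lam f → B (vec lam f) = φ f • vec lam f) :
    (fun T : StdTableau lam => φ T.1) ∈ diagonals lam := by
  have heq : diagOp lam (fun T => φ T.1) = B :=
    end_ext fun f hf => by rw [h f hf, diagOp_vec]
  rwa [diagonals, Subalgebra.mem_comap, heq]

theorem torusOp_mulSingle_vec (a : Fin n) (z : ℂ) (f : Fin n → Box p d) :
    torusOp lam (Pi.mulSingle a z) (vec lam f) = z ^ weight f a • vec lam f := by
  rw [torusOp_vec, Fintype.prod_eq_single a, Pi.mulSingle_eq_same, weight]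
  intro k hk
  rw [Pi.mulSingle_eq_of_ne hk, one_pow]

/-- The recursion `J_{k+1} = s_k J_k s_k + s_k Π_k` of the Jucys–Murphy elements, where `Π_k` is the
projection to the span of the tableaux with `k` and `k + 1` in the same diagram. -/
theorem jucysMurphy_succ {a b : Fin n} (hab : (a : ℕ) + 1 = b) {f : Fin n → Box p d}
    (hf : IsStd lam f) :
    (swapOp lam a b * diagOp lam (fun T => (content T.1 a : ℂ)) * swapOp lam a b +
      swapOp lam a b * diagOp lam (fun T => if (T.1 a).1 = (T.1 b).1 then 1 else 0)) (vec lam f) =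
      (content f b : ℂ) • vec lam f := by
  have hcontent : content (f ∘ Equiv.swap a b) a = content f b := by
    simp only [content, Function.comp_apply, Equiv.swap_apply_left]
  have h : diagOp lam (fun T => (content T.1 a : ℂ)) (swapOp lam a b (vec lam f)) +
      diagOp lam (fun T => if (T.1 a).1 = (T.1 b).1 then 1 else 0) (vec lam f) =
        (content f b : ℂ) • swapOp lam a b (vec lam f) := by
    rw [diagOp_vec (fun f => if (f a).1 = (f b).1 then 1 else 0), ← hf.axial_mul_content_sub hab,
      swapOp_vec lam hab, map_add, map_smul, map_smul, diagOp_vec (fun f => (content f a : ℂ)),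
      diagOp_vec (fun f => (content f a : ℂ)), hcontent]
    module
  rw [LinearMap.add_apply, Module.End.mul_apply, Module.End.mul_apply, Module.End.mul_apply,
    ← map_add, h, map_smul, ← Module.End.mul_apply, swapOp_sq lam hab, Module.End.one_apply]

variable [NeZero d]

theorem pow_weight_mem_diagonals {ζ : ℂ} (hζ : ζ ^ d = 1) (a : Fin n) :
    (fun T : StdTableau lam => ζ ^ weight T.1 a) ∈ diagonals lam := by
  refine mem_diagonals_of_vec (φ := fun f => ζ ^ weight f a) (torusOp_mem_groupOperators ?_ ?_)
    fun f _ => torusOp_mulSingle_vec a ζ f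
  · rw [← Pi.mulSingle_pow, mul_comm, pow_mul, hζ, one_pow, Pi.mulSingle_one]
  · rw [Fintype.prod_pi_mulSingle', hζ]

theorem pow_weight_mul_inv_mem_diagonals {ζ : ℂ} (hζ : ζ ^ (p * d) = 1) (a b : Fin n) :
    (fun T : StdTableau lam => ζ ^ weight T.1 a * ζ⁻¹ ^ weight T.1 b) ∈ diagonals lam := by
  have hζ0 : ζ ≠ 0 := fun h => by simp [h, NeZero.ne] at hζ
  refine mem_diagonals_of_vec (φ := fun f => ζ ^ weight f a * ζ⁻¹ ^ weight f b)
    (torusOp_mem_groupOperators (θ := Pi.mulSingle a ζ * Pi.mulSingle b ζ⁻¹) ?_ ?_) fun f _ => ?_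
  · rw [mul_pow, ← Pi.mulSingle_pow, ← Pi.mulSingle_pow, inv_pow, hζ, inv_one, Pi.mulSingle_one,
      Pi.mulSingle_one, mul_one]
  · simp only [Pi.mul_apply]
    rw [Finset.prod_mul_distrib, Fintype.prod_pi_mulSingle', Fintype.prod_pi_mulSingle',
      mul_inv_cancel₀ hζ0, one_pow]
  · have hmul : torusOp lam (Pi.mulSingle a ζ * Pi.mulSingle b ζ⁻¹) =
        torusOp lam (Pi.mulSingle a ζ) * torusOp lam (Pi.mulSingle b ζ⁻¹) := torusOp_mul lam _ _
    rw [hmul, Module.End.mul_apply, torusOp_mulSingle_vec, map_smul, torusOp_mulSingle_vec,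
      smul_smul, mul_comm]

theorem indicator_mem_diagonals (a b : Fin n) :
    (fun T : StdTableau lam => if (T.1 a).1 = (T.1 b).1 then (1 : ℂ) else 0) ∈ diagonals lam := by
  have hζ := Complex.isPrimitiveRoot_exp (p * d) (NeZero.ne _)
  set ζ := Complex.exp (2 * Real.pi * Complex.I / (p * d : ℕ))
  have hiff : ∀ T : StdTableau lam, (T.1 a).1 = (T.1 b).1 ↔
      ζ ^ weight T.1 a * ζ⁻¹ ^ weight T.1 b = 1 := fun T => by
    rw [inv_pow, mul_inv_eq_one₀ (pow_ne_zero _ (hζ.ne_zero (NeZero.ne _))), ← weight_eq_iff]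
    exact ⟨fun h => by rw [h], fun h => hζ.pow_inj (weight_lt _ _) (weight_lt _ _) h⟩
  refine mem_subalgebra_of_separated _ fun T T' h => ?_
  have hT := h _ (pow_weight_mul_inv_mem_diagonals hζ.pow_eq_one a b)
  simp only [hiff, hT]

theorem content_mem_diagonals (k : Fin n) :
    (fun T : StdTableau lam => (content T.1 k : ℂ)) ∈ diagonals lam := by
  obtain ⟨k, hk⟩ := k
  induction k with
  | zero =>
    have hzero : (fun T : StdTableau lam => (content T.1 ⟨0, hk⟩ : ℂ)) = 0 :=
      funext fun T => by rw [T.2.content_zero hk, Int.cast_zero, Pi.zero_apply]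
    exact hzero ▸ zero_mem _
  | succ k ih =>
    have hk' : k < n := Nat.lt_of_succ_lt hk
    have hswap : swapOp lam ⟨k, hk'⟩ ⟨k + 1, hk⟩ ∈ groupOperators lam :=
      swapOp_mem_groupOperators rfl
    exact mem_diagonals_of_vec (φ := fun f => (content f ⟨k + 1, hk⟩ : ℂ))
      (add_mem (mul_mem (mul_mem hswap (ih hk')) hswap)
        (mul_mem hswap (indicator_mem_diagonals ⟨k, hk'⟩ ⟨k + 1, hk⟩)))
      fun f hf => jucysMurphy_succ rfl hf

variable {T T' : StdTableau lam}

theorem snd_eq_of_not_separated (h : ∀ φ ∈ diagonals lam, φ T = φ T') (a : Fin n) :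
    (T'.1 a).1.2 = (T.1 a).1.2 := by
  have hζ := Complex.isPrimitiveRoot_exp d (NeZero.ne _)
  have hpow := h _ (pow_weight_mem_diagonals hζ.pow_eq_one a)
  rw [(hζ.isOfFinOrder (NeZero.ne _)).pow_eq_pow_iff_modEq, ← hζ.eq_orderOf] at hpow
  rw [Fin.ext_iff, ← weight_mod, ← weight_mod]
  exact hpow.symm

theorem fst_add_fst_of_not_separated (h : ∀ φ ∈ diagonals lam, φ T = φ T') (a b : Fin n) :
    (T'.1 a).1.1 + (T.1 b).1.1 = (T.1 a).1.1 + (T'.1 b).1.1 := by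
  have hζ := Complex.isPrimitiveRoot_exp (p * d) (NeZero.ne _)
  set ζ := Complex.exp (2 * Real.pi * Complex.I / (p * d : ℕ))
  have hζ0 : ζ ≠ 0 := hζ.ne_zero (NeZero.ne _)
  have hpow := h _ (pow_weight_mul_inv_mem_diagonals hζ.pow_eq_one a b)
  rw [inv_pow, inv_pow, ← div_eq_mul_inv, ← div_eq_mul_inv,
    div_eq_div_iff (pow_ne_zero _ hζ0) (pow_ne_zero _ hζ0), ← pow_add, ← pow_add,
    (hζ.isOfFinOrder (NeZero.ne _)).pow_eq_pow_iff_modEq, ← hζ.eq_orderOf] at hpow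
  have hmod : d * ((T'.1 a).1.1.val + (T.1 b).1.1.val) ≡
      d * ((T.1 a).1.1.val + (T'.1 b).1.1.val) [MOD d * p] := by
    refine Nat.ModEq.add_right_cancel' ((T.1 a).1.2 + (T.1 b).1.2 : ℕ) ?_
    rw [mul_comm d p]
    convert hpow.symm using 1 <;> rw [weight, weight, snd_eq_of_not_separated h] <;> ring
  have hcast := (ZMod.natCast_eq_natCast_iff _ _ _).2 (hmod.mul_left_cancel' (NeZero.ne d))
  simpa only [Nat.cast_add, ZMod.natCast_zmod_val] using hcast

theorem exists_shift_of_not_separated [NeZero n] (h : ∀ φ ∈ diagonals lam, φ T = φ T') :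
    ∃ j, T'.1 = shiftFilling (j * orbitLength lam) T.1 := by
  set m : ℕ := ((T.1 0).1.1 - (T'.1 0).1.1).val with hm
  have hshift : IsStd (MultiPartition.shift^[m] lam) (shiftFilling m T.1) :=
    (isStd_shiftFilling_iff m).2 T.2
  have hT' : T'.1 = shiftFilling m T.1 := by
    refine T'.2.eq_of_content hshift (fun a => Prod.ext ?_ (snd_eq_of_not_separated h a))
      fun a => Int.cast_injective (h _ (content_mem_diagonals a)).symm
    change (T'.1 a).1.1 = (T.1 a).1.1 - (m : ZMod p)
    rw [hm, ZMod.natCast_zmod_val]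
    linear_combination fst_add_fst_of_not_separated h a 0
  obtain ⟨j, hj⟩ := (shift_iterate_eq_self_iff lam m).1 ((hT' ▸ hshift).shape_unique T'.2)
  exact ⟨j, by rw [hT', hj, mul_comm]⟩

end GroupOperators

section Atom

variable {k G M : Type*} [CommRing k] [Monoid G] [AddCommGroup M] [Module k M]
  {ρ : Representation k G M}

/-- The subrepresentations of a subrepresentation `X` are the subrepresentations contained in
`X`. -/
def subrepresentationMapIic (X : Subrepresentation ρ) :
    Subrepresentation X.toRepresentation ≃o Set.Iic X where
  toFun Y := ⟨⟨Y.toSubmodule.map X.toSubmodule.subtype, by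
      rintro g _ ⟨y, hy, rfl⟩
      exact ⟨X.toRepresentation g y, Y.apply_mem_toSubmodule g hy, rfl⟩⟩,
    Submodule.map_subtype_le X.toSubmodule Y.toSubmodule⟩
  invFun Z := ⟨Z.1.toSubmodule.comap X.toSubmodule.subtype,
    fun g _ hv => Z.1.apply_mem_toSubmodule g hv⟩
  left_inv Y := Subrepresentation.toSubmodule_injective
    (X.toSubmodule.mapIic.left_inv Y.toSubmodule)
  right_inv Z := Subtype.ext <| Subrepresentation.toSubmodule_injective <|
    congrArg Subtype.val (X.toSubmodule.mapIic.right_inv ⟨Z.1.toSubmodule, Z.2⟩)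
  map_rel_iff' := X.toSubmodule.mapIic.map_rel_iff

theorem isSimpleOrder_subrepresentation_iff_isAtom {X : Subrepresentation ρ} :
    IsSimpleOrder (Subrepresentation X.toRepresentation) ↔ IsAtom X :=
  (subrepresentationMapIic X).isSimpleOrder_iff.trans Set.isSimpleOrder_Iic_iff_isAtom

end Atom

section Irreducibility

theorem coeffAux_ne_zero {α : ℂ} (h : α ^ 2 ≠ 1) : coeffAux α ≠ 0 := by
  rw [coeffAux, if_neg h]
  refine fun h0 => h ?_
  rw [eq_neg_of_add_eq_zero_right h0, neg_sq, one_pow]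

variable {p d n : ℕ} [NeZero p] {lam : MultiPartition p d n}

theorem apply_mem_of_apply_vec_mem {A : Module.End ℂ (VMod lam)} {S : Submodule ℂ (VMod lam)}
    {v : VMod lam} (h : ∀ T ∈ v.support, A (vec lam T.1) ∈ S) : A v ∈ S := by
  rw [← Finsupp.sum_single v, Finsupp.sum, map_sum]
  refine Submodule.sum_mem _ fun T hT => ?_
  rw [← Finsupp.smul_single_one, map_smul, ← vec_std]
  exact S.smul_mem _ (h T hT)

theorem vec_apply_of_ne {f : Fin n → Box p d} {T : StdTableau lam} (h : f ≠ T.1) :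
    vec lam f T = 0 := by
  by_cases hf : IsStd lam f
  · rw [vec_std (⟨f, hf⟩ : StdTableau lam)]
    exact Finsupp.single_eq_of_ne fun hT => h (congrArg Subtype.val hT).symm
  · rw [vec_not hf, Finsupp.zero_apply]

/-- The eigenvalue `exp(2 π i l / e_λ)`. -/
noncomputable def shiftEigenvalue (lam : MultiPartition p d n) (l : ℕ) : ℂ :=
  Complex.exp (2 * Real.pi * Complex.I * l / eNumber lam)

theorem shiftEigenvalue_eq_pow (lam : MultiPartition p d n) (l : ℕ) :
    shiftEigenvalue lam l = Complex.exp (2 * Real.pi * Complex.I / eNumber lam) ^ l := by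
  rw [← Complex.exp_nat_mul, shiftEigenvalue, mul_div_assoc', mul_comm (l : ℂ)]

theorem shiftEigenvalue_ne_zero (lam : MultiPartition p d n) (l : ℕ) :
    shiftEigenvalue lam l ≠ 0 := Complex.exp_ne_zero _

theorem shiftEigenvalue_pow (lam : MultiPartition p d n) (l : ℕ) :
    shiftEigenvalue lam l ^ eNumber lam = 1 := by
  rw [shiftEigenvalue_eq_pow, pow_right_comm,
    (Complex.isPrimitiveRoot_exp (eNumber lam) (NeZero.ne _)).pow_eq_one, one_pow]

theorem mem_VBar {l : ℕ} {v : VMod lam} :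
    v ∈ VBar lam l ↔ shiftOp lam (orbitLength lam) v = shiftEigenvalue lam l • v := by
  rw [← div_eNumber]
  exact Module.End.mem_eigenspace_iff

theorem IsStd.shiftFilling_mul_orbitLength {f : Fin n → Box p d} (hf : IsStd lam f) (j : ℕ) :
    IsStd lam (shiftFilling (j * orbitLength lam) f) := by
  have h := (isStd_shiftFilling_iff (j * orbitLength lam)).2 hf
  rwa [(shift_iterate_eq_self_iff lam _).2 (dvd_mul_left _ _)] at h

theorem shiftOp_orbitLength_pow_vec {f : Fin n → Box p d} (hf : IsStd lam f) (j : ℕ) :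
    (shiftOp lam (orbitLength lam) ^ j) (vec lam f) =
      vec lam (shiftFilling (j * orbitLength lam) f) := by
  induction j with
  | zero => rw [pow_zero, zero_mul, shiftFilling_of_dvd (dvd_zero p), Module.End.one_apply]
  | succ j ih =>
    rw [pow_succ', Module.End.mul_apply, ih, shiftOp_vec _ (hf.shiftFilling_mul_orbitLength j),
      shiftFilling_shiftFilling, Nat.succ_mul, add_comm]

theorem shiftOp_orbitLength_pow_eNumber (lam : MultiPartition p d n) :
    shiftOp lam (orbitLength lam) ^ eNumber lam = 1 :=
  end_ext fun f hf => by
    rw [shiftOp_orbitLength_pow_vec hf, eNumber_mul, Module.End.one_apply,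
      shiftFilling_of_dvd dvd_rfl]

theorem commute_VRes_shiftOp (m : ℕ) (w : imprimitiveGroup (p * d) p n) :
    Commute (VRes lam w) (shiftOp lam m) := by
  obtain ⟨θ, σ, hθ, hprod, hw⟩ := w.2
  rw [Nat.mul_div_cancel_left _ (NeZero.pos p)] at hprod
  rw [VRes_apply w hw]
  have htorus : Commute (torusOp lam θ) (shiftOp lam m) :=
    (shiftOp_torusOp lam m hθ hprod).symm
  have hperm : Commute (permRep lam σ) (shiftOp lam m) := (shiftOp_permRep lam m σ).symm
  exact htorus.mul_left hperm

/-- The projection of `V(λ)` to `V(λ̄, l)`. -/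
noncomputable def VBarProj (lam : MultiPartition p d n) (l : ℕ) : Module.End ℂ (VMod lam) :=
  eigenProj (shiftOp lam (orbitLength lam)) (eNumber lam) (shiftEigenvalue lam l)

theorem shiftOp_mul_VBarProj (l : ℕ) : shiftOp lam (orbitLength lam) * VBarProj lam l =
    shiftEigenvalue lam l • VBarProj lam l :=
  mul_eigenProj (shiftOp_orbitLength_pow_eNumber lam) (shiftEigenvalue_pow lam l) (NeZero.ne _)

theorem VBarProj_mem (l : ℕ) (v : VMod lam) : VBarProj lam l v ∈ VBar lam l := by
  rw [mem_VBar, ← Module.End.mul_apply, shiftOp_mul_VBarProj, LinearMap.smul_apply]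

theorem VBarProj_of_mem {l : ℕ} {v : VMod lam} (hv : v ∈ VBar lam l) : VBarProj lam l v = v :=
  eigenProj_apply_of_eq_smul (mem_VBar.1 hv) (shiftEigenvalue_ne_zero lam l) (NeZero.ne _)

theorem VBarProj_of_mem_ne {l l' : ℕ} (h : shiftEigenvalue lam l ≠ shiftEigenvalue lam l')
    {v : VMod lam} (hv : v ∈ VBar lam l') : VBarProj lam l v = 0 :=
  eigenProj_apply_of_eq_smul_ne (mem_VBar.1 hv) h (shiftOp_orbitLength_pow_eNumber lam)
    (shiftEigenvalue_pow lam l) (NeZero.ne _)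

theorem commute_VRes_VBarProj (l : ℕ) (w : imprimitiveGroup (p * d) p n) :
    Commute (VRes lam w) (VBarProj lam l) :=
  commute_eigenProj (commute_VRes_shiftOp _ w)

theorem commute_swapOp_VBarProj (l : ℕ) {a b : Fin n} (hab : (a : ℕ) + 1 = b) :
    Commute (swapOp lam a b) (VBarProj lam l) :=
  commute_eigenProj (shiftOp_swapOp lam _ hab).symm

theorem sum_VBarProj (lam : MultiPartition p d n) (t : ℕ) :
    ∑ l ∈ Finset.range (eNumber lam), VBarProj lam (l + t) = 1 := by
  simp only [VBarProj, shiftEigenvalue_eq_pow]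
  exact sum_eigenProj (Complex.isPrimitiveRoot_exp _ (NeZero.ne _)) (NeZero.ne _) t

theorem VBarProj_vec_shiftFilling (l j : ℕ) {f : Fin n → Box p d} (hf : IsStd lam f) :
    VBarProj lam l (vec lam (shiftFilling (j * orbitLength lam) f)) =
      shiftEigenvalue lam l ^ j • VBarProj lam l (vec lam f) := by
  have hcomm : Commute (shiftOp lam (orbitLength lam)) (VBarProj lam l) :=
    commute_eigenProj (Commute.refl _)
  rw [← shiftOp_orbitLength_pow_vec hf, ← Module.End.mul_apply, ← (hcomm.pow_left j).eq]
  induction j with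
  | zero => rw [pow_zero, pow_zero, one_mul, one_smul]
  | succ j ih =>
    rw [pow_succ', mul_assoc, Module.End.mul_apply, ih, map_smul, ← Module.End.mul_apply,
      shiftOp_mul_VBarProj, LinearMap.smul_apply, smul_smul, pow_succ]

theorem VBar_zero_eq_top (h : eNumber lam = 1) : VBar lam 0 = ⊤ := by
  refine top_le_iff.1 fun v _ => mem_VBar.2 ?_
  have hone := shiftOp_orbitLength_pow_eNumber lam
  rw [h, pow_one] at hone
  rw [hone, shiftEigenvalue_eq_pow, pow_zero, one_smul, Module.End.one_apply]

theorem VBarProj_vec_comp_swap_mem {l : ℕ} {X : Subrepresentation (VRes lam)}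
    {f : Fin n → Box p d} {a b : Fin n} (hab : (a : ℕ) + 1 = b) (hf : IsStd lam f)
    (hswap : IsStd lam (f ∘ Equiv.swap a b))
    (hX : VBarProj lam l (vec lam f) ∈ X) :
    VBarProj lam l (vec lam (f ∘ Equiv.swap a b)) ∈ X := by
  have h : swapOp lam a b (VBarProj lam l (vec lam f)) ∈ X.toSubmodule :=
    apply_mem_of_mem_groupOperators X (swapOp_mem_groupOperators hab) _ hX
  rw [← Module.End.mul_apply, (commute_swapOp_VBarProj l hab).eq, Module.End.mul_apply,
    swapOp_vec lam hab, map_add, map_smul, map_smul,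
    X.toSubmodule.add_mem_iff_right (X.toSubmodule.smul_mem _ hX),
    X.toSubmodule.smul_mem_iff (coeffAux_ne_zero (hf.axial_sq_ne_one hab hswap))] at h
  exact h

variable [NeZero n]

theorem VBarProj_vec_apply_self (l : ℕ) (T : StdTableau lam) :
    VBarProj lam l (vec lam T.1) T = (eNumber lam : ℂ)⁻¹ := by
  rw [VBarProj, eigenProj, LinearMap.smul_apply, LinearMap.sum_apply, Finsupp.smul_apply,
    Finsupp.finsetSum_apply, Finset.sum_eq_single_of_mem 0 (Finset.mem_range.2 (NeZero.pos _))]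
  · rw [pow_zero, Module.End.one_apply, vec_std, Finsupp.single_eq_same, smul_eq_mul, mul_one]
  · intro j hj hj0
    rw [smul_pow, LinearMap.smul_apply, shiftOp_orbitLength_pow_vec T.2, Finsupp.smul_apply,
      vec_apply_of_ne, smul_zero]
    rw [Ne, shiftFilling_eq_self_iff]
    exact fun hdvd => Nat.not_dvd_of_pos_of_lt (Nat.pos_of_ne_zero hj0) (Finset.mem_range.1 hj)
      (Nat.dvd_of_mul_dvd_mul_right (orbitLength_pos lam) (by rwa [eNumber_mul]))

theorem VBar_ne_bot (lam : MultiPartition p d n) (l : ℕ) : VBar lam l ≠ ⊥ := by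
  obtain ⟨f, hf⟩ := exists_isStd lam
  intro h
  have hmem := VBarProj_mem l (vec lam f)
  rw [h] at hmem
  have hzero : VBarProj lam l (vec lam f) = 0 := (Submodule.mem_bot ℂ).1 hmem
  have hself := VBarProj_vec_apply_self l (⟨f, hf⟩ : StdTableau lam)
  rw [hzero, Finsupp.zero_apply] at hself
  exact NeZero.ne (eNumber lam : ℂ) (inv_eq_zero.1 hself.symm)

variable [NeZero d] {l : ℕ} {X : Subrepresentation (VRes lam)}

theorem exists_VBarProj_vec_mem (hle : X ≤ VBar lam l) (hne : X ≠ ⊥) :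
    ∃ T : StdTableau lam, VBarProj lam l (vec lam T.1) ∈ X := by
  classical
  have hne' : X.toSubmodule ≠ ⊥ := fun h => hne (Subrepresentation.toSubmodule_injective h)
  obtain ⟨u, hu, hu0⟩ := X.toSubmodule.ne_bot_iff.1 hne'
  obtain ⟨T, hT⟩ := Finsupp.ne_iff.1 hu0
  let φ (T' : StdTableau lam) : ℂ := if ∀ ψ ∈ diagonals lam, ψ T = ψ T' then 1 else 0
  have hφ : φ ∈ diagonals lam := by
    refine mem_subalgebra_of_separated _ fun x y h => if_congr ?_ rfl rfl
    exact forall₂_congr fun ψ hψ => by rw [h ψ hψ]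
  let x := diagOp lam φ u
  have hxX : x ∈ X := apply_mem_of_mem_groupOperators X hφ u hu
  have hxT : x T = u T := by
    have hφT : φ T = 1 := if_pos fun _ _ => rfl
    rw [diagOp_apply, hφT, one_mul]
  have hspan : VBarProj lam l x ∈ Submodule.span ℂ {VBarProj lam l (vec lam T.1)} := by
    refine apply_mem_of_apply_vec_mem fun T' hT' => ?_
    rw [Finsupp.mem_support_iff, diagOp_apply] at hT'
    have hsep : ∀ ψ ∈ diagonals lam, ψ T = ψ T' := of_not_not fun h =>
      left_ne_zero_of_mul hT' (if_neg h)
    obtain ⟨j, hj⟩ := exists_shift_of_not_separated hsep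
    rw [hj, VBarProj_vec_shiftFilling l j T.2]
    exact Submodule.mem_span_singleton.2 ⟨_, rfl⟩
  rw [VBarProj_of_mem (hle hxX), Submodule.mem_span_singleton] at hspan
  obtain ⟨s, hs⟩ := hspan
  have hs0 : s ≠ 0 := by
    rintro rfl
    exact hT (by rw [← hxT, ← hs, zero_smul])
  exact ⟨T, (X.toSubmodule.smul_mem_iff hs0).1 (hs ▸ hxX)⟩

theorem isAtom_VBar (lam : MultiPartition p d n) (l : ℕ) : IsAtom (VBar lam l) := by
  refine isAtom_iff_le_of_ge.2 ⟨VBar_ne_bot lam l, fun X hne hle v hv => ?_⟩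
  obtain ⟨T, hT⟩ := exists_VBarProj_vec_mem hle hne
  have hall : ∀ T' : StdTableau lam, VBarProj lam l (vec lam T'.1) ∈ X.toSubmodule := fun T' =>
    IsStd.swap_induction (P := fun f => VBarProj lam l (vec lam f) ∈ X) T.2 hT
      (fun _ _ _ hab hf hswap => VBarProj_vec_comp_swap_mem hab hf hswap) T'.2
  rw [← VBarProj_of_mem hv]
  exact apply_mem_of_apply_vec_mem fun T' _ => hall T'

theorem isIrreducible_VBarRep (lam : MultiPartition p d n) (l : ℕ) :
    (VBarRep lam l).IsIrreducible :=
  isSimpleOrder_subrepresentation_iff_isAtom.2 (isAtom_VBar lam l)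

theorem isIrreducible_VRes (h : eNumber lam = 1) : (VRes lam).IsIrreducible :=
  isSimpleOrder_iff_isAtom_top.2 (VBar_zero_eq_top h ▸ isAtom_VBar lam 0)

end Irreducibility

section Normalizer

theorem IsMonomial.inv {n : ℕ} {w : EuclideanSpace ℂ (Fin n) ≃ₗᵢ[ℂ] EuclideanSpace ℂ (Fin n)}
    {θ : Fin n → ℂ} {σ : Equiv.Perm (Fin n)} (h : IsMonomial w θ σ) :
    IsMonomial w⁻¹ (fun i => (θ (σ i))⁻¹) σ⁻¹ := fun v i => by
  have hv := h (w.symm v) (σ i)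
  rw [LinearIsometryEquiv.apply_symm_apply, Equiv.symm_apply_apply] at hv
  change w.symm v i = (θ (σ i))⁻¹ * v (σ i)
  rw [hv, inv_mul_cancel_left₀ (h.ne_zero _)]

theorem conj_mem_imprimitiveGroup {r p n : ℕ}
    {g h : EuclideanSpace ℂ (Fin n) ≃ₗᵢ[ℂ] EuclideanSpace ℂ (Fin n)}
    (hg : g ∈ imprimitiveGroup r 1 n) (hh : h ∈ imprimitiveGroup r p n) :
    g * h * g⁻¹ ∈ imprimitiveGroup r p n := by
  obtain ⟨θ, σ, hθ, _, hmon⟩ := hg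
  obtain ⟨θ', σ', hθ', hprod, hmon'⟩ := hh
  refine ⟨_, _, fun i => ?_, ?_, (hmon.mul hmon').mul hmon.inv⟩
  · rw [mul_pow, mul_pow, hθ, hθ', inv_pow, hθ, inv_one, mul_one, mul_one]
  · rw [Finset.prod_mul_distrib, Finset.prod_mul_distrib, Equiv.prod_comp σ.symm θ',
      Equiv.prod_comp (σ * σ').symm fun i => (θ (σ i))⁻¹, Equiv.prod_comp σ fun i => (θ i)⁻¹,
      Finset.prod_inv_distrib, mul_comm (∏ i, θ i), mul_inv_cancel_right₀, hprod]
    exact Finset.prod_ne_zero_iff.2 fun i _ => hmon.ne_zero i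

theorem imprimitiveGroup_le_normalizer (r p n : ℕ) : imprimitiveGroup r 1 n ≤
    Subgroup.normalizer (imprimitiveGroup r p n : Set (EuclideanSpace ℂ (Fin n) ≃ₗᵢ[ℂ] _)) := by
  refine fun g hg => Subgroup.mem_normalizer_iff.2 fun h =>
    ⟨conj_mem_imprimitiveGroup hg, fun hh => ?_⟩
  have hconj := conj_mem_imprimitiveGroup (inv_mem hg) hh
  rwa [inv_inv, ← mul_assoc, ← mul_assoc, inv_mul_cancel, one_mul, inv_mul_cancel_right] at hconj

end Normalizer

section ShiftEquiv

variable {p d n : ℕ} [NeZero p] {lam mu : MultiPartition p d n}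

/-- The `m`-fold shift of tableaux as a bijection onto the tableaux of the shifted shape. -/
def stdShift (lam : MultiPartition p d n) (m : ℕ) :
    StdTableau lam ≃ StdTableau (MultiPartition.shift^[m] lam) :=
  ((Equiv.refl (Fin n)).arrowCongr (boxShift p d m)).subtypeEquiv fun _ =>
    (isStd_shiftFilling_iff m).symm

/-- The linear isomorphism `v(T) ↦ v(shift^m T)`. -/
noncomputable def shiftEquiv (lam : MultiPartition p d n) (m : ℕ) :
    VMod lam ≃ₗ[ℂ] VMod (MultiPartition.shift^[m] lam) :=
  Finsupp.domLCongr (stdShift lam m)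

theorem shiftEquiv_vec (m : ℕ) (f : Fin n → Box p d) :
    shiftEquiv lam m (vec lam f) = vec (MultiPartition.shift^[m] lam) (shiftFilling m f) := by
  by_cases hf : IsStd lam f
  · rw [vec, dif_pos hf, vec, dif_pos ((isStd_shiftFilling_iff m).2 hf)]
    exact Finsupp.domLCongr_single _ _ _
  · rw [vec_not hf, map_zero, vec_not (mt (isStd_shiftFilling_iff m).1 hf)]

theorem shiftEquiv_comp_swapOp (m : ℕ) {a b : Fin n} (hab : (a : ℕ) + 1 = b) :
    (shiftEquiv lam m).toLinearMap ∘ₗ swapOp lam a b =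
      swapOp (MultiPartition.shift^[m] lam) a b ∘ₗ (shiftEquiv lam m).toLinearMap :=
  end_ext fun f _ => by
    rw [LinearMap.comp_apply, LinearMap.comp_apply, LinearEquiv.coe_coe, swapOp_vec lam hab,
      shiftEquiv_vec, swapOp_vec _ hab, map_add, map_smul, map_smul, shiftEquiv_vec,
      shiftEquiv_vec, axial_shiftFilling]
    rfl

theorem shiftEquiv_comp_permRep (m : ℕ) (σ : Equiv.Perm (Fin n)) :
    (shiftEquiv lam m).toLinearMap ∘ₗ permRep lam σ =
      permRep (MultiPartition.shift^[m] lam) σ ∘ₗ (shiftEquiv lam m).toLinearMap := by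
  refine perm_induction (P := fun σ => (shiftEquiv lam m).toLinearMap ∘ₗ permRep lam σ =
    permRep _ σ ∘ₗ (shiftEquiv lam m).toLinearMap) ?_ (fun i h => ?_) (fun σ τ hσ hτ => ?_) σ
  · rw [map_one, map_one, Module.End.one_eq_id, Module.End.one_eq_id, LinearMap.comp_id,
      LinearMap.id_comp]
  · rw [permRep_swap, permRep_swap, shiftEquiv_comp_swapOp m rfl]
  · rw [map_mul, map_mul, Module.End.mul_eq_comp, Module.End.mul_eq_comp, ← LinearMap.comp_assoc,
      hσ, LinearMap.comp_assoc, hτ, LinearMap.comp_assoc]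

theorem shiftEquiv_comp_torusOp (m : ℕ) {θ : Fin n → ℂ} (hθ : ∀ i, θ i ^ (p * d) = 1)
    (hprod : (∏ i, θ i) ^ d = 1) :
    (shiftEquiv lam m).toLinearMap ∘ₗ torusOp lam θ =
      torusOp (MultiPartition.shift^[m] lam) θ ∘ₗ (shiftEquiv lam m).toLinearMap := by
  refine end_ext fun f _ => ?_
  rw [LinearMap.comp_apply, LinearMap.comp_apply, LinearEquiv.coe_coe, torusOp_vec, map_smul,
    shiftEquiv_vec, torusOp_vec]
  congr 1
  have hprod_pow : ∏ i, (θ i ^ d) ^ m = 1 := by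
    rw [Finset.prod_pow, Finset.prod_pow, hprod, one_pow]
  rw [← mul_one (∏ i, θ i ^ (d * (shiftFilling m f i).1.1.val + _)), ← hprod_pow,
    ← Finset.prod_mul_distrib]
  refine Finset.prod_congr rfl fun i _ => ?_
  rw [pow_add, pow_add, pow_val_sub d m _ (hθ i), mul_right_comm]
  rfl

theorem CyclicEquiv.nonempty_equiv (h : CyclicEquiv lam mu) :
    Nonempty (Representation.Equiv (VRes lam) (VRes mu)) := by
  obtain ⟨m, rfl⟩ := h
  refine ⟨.mk (shiftEquiv lam m) fun w => ?_⟩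
  obtain ⟨θ, σ, hθ, hprod, hw⟩ := w.2
  rw [Nat.mul_div_cancel_left _ (NeZero.pos p)] at hprod
  rw [VRes_apply w hw, VRes_apply w hw, Module.End.mul_eq_comp, Module.End.mul_eq_comp,
    ← LinearMap.comp_assoc, shiftEquiv_comp_torusOp m hθ hprod, LinearMap.comp_assoc,
    shiftEquiv_comp_permRep, LinearMap.comp_assoc]

end ShiftEquiv

section Decomposition

variable {p d n : ℕ} [NeZero p] {lam mu : MultiPartition p d n}

theorem shiftEigenvalue_injOn (lam : MultiPartition p d n) (t : ℕ) :
    Set.InjOn (fun l => shiftEigenvalue lam (l + t)) (Set.Iio (eNumber lam)) := by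
  intro l hl l' hl' h
  simp only [shiftEigenvalue_eq_pow, pow_add] at h
  exact (Complex.isPrimitiveRoot_exp _ (NeZero.ne _)).pow_inj hl hl'
    (mul_right_cancel₀ (pow_ne_zero _ (Complex.exp_ne_zero _)) h)

/-- The inclusion of `V(λ̄, l)` in `V(λ)`. -/
noncomputable def VBarIncl (lam : MultiPartition p d n) (l : ℕ) :
    Representation.IntertwiningMap (VBarRep lam l) (VRes lam) where
  toLinearMap := (VBar lam l).toSubmodule.subtype
  isIntertwining' _ := rfl

/-- The projection of `V(λ)` to `V(λ̄, l)`, with values in `V(λ̄, l)`. -/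
noncomputable def VBarRetract (lam : MultiPartition p d n) (l : ℕ) :
    Representation.IntertwiningMap (VRes lam) (VBarRep lam l) where
  toLinearMap := (VBarProj lam l).codRestrict (VBar lam l).toSubmodule (VBarProj_mem l)
  isIntertwining' w := LinearMap.ext fun v => Subtype.ext <|
    LinearMap.congr_fun (commute_VRes_VBarProj l w).eq.symm v

variable (c : (EuclideanSpace ℂ (Fin n) ≃ₗᵢ[ℂ] EuclideanSpace ℂ (Fin n)) → ℂ)

theorem nonempty_standardModule_VRes_equiv_directSum (lam : MultiPartition p d n) (t : ℕ) :
    Nonempty (StandardModule (imprimitiveGroup (p * d) p n) c (VRes lam) ≃ₗ[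
      CherednikAlgebra (imprimitiveGroup (p * d) p n) c]
      ⨁ l : Fin (eNumber lam), StandardModule (imprimitiveGroup (p * d) p n) c
        (VBarRep lam (l + t))) := by
  refine StandardModule.nonempty_linearEquiv_directSum (fun l => VBarIncl lam (l + t))
    (fun l => VBarRetract lam (l + t)) (fun l v => ?_) (fun l l' hne v => ?_) (fun v => ?_)
  · exact Subtype.ext (VBarProj_of_mem (Subtype.property v))
  · exact Subtype.ext (VBarProj_of_mem_ne
      (fun h => hne (Fin.ext (shiftEigenvalue_injOn lam t l.2 l'.2 h))) (Subtype.property v))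
  · change ∑ l : Fin (eNumber lam), VBarProj lam (l + t) v = v
    rw [← LinearMap.sum_apply, Fin.sum_univ_eq_sum_range fun l => VBarProj lam (l + t),
      sum_VBarProj, Module.End.one_apply]

variable [NeZero d] {c}
  (hinv : ∀ w ∈ imprimitiveGroup (p * d) 1 n, ∀ g ∈ imprimitiveGroup (p * d) p n,
    IsReflection g → c (w * g * w⁻¹) = c g)
  (hc : ∀ g ∈ imprimitiveGroup (p * d) 1 n, IsReflection g →
    g ∉ imprimitiveGroup (p * d) p n → c g = 0)

include hinv

theorem restrictsTo_VRes (h : CyclicEquiv lam mu) :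
    RestrictsTo (CherednikAlgebra.incl c (imprimitiveGroup_le (p * d) p n) hc)
      (StandardModule (imprimitiveGroup (p * d) 1 n) c (VRep lam))
      (StandardModule (imprimitiveGroup (p * d) p n) c (VRes mu)) := by
  obtain ⟨e⟩ := h.nonempty_equiv
  obtain ⟨E⟩ := StandardModule.nonempty_linearEquiv (c := c) e
  exact (restrictsTo_standardModule (VRep lam) (imprimitiveGroup_le (p * d) p n)
    (imprimitiveGroup_le_normalizer (p * d) p n) hc hinv).trans_linearEquiv E

theorem restrictsTo_directSum (h : CyclicEquiv lam mu) (t : ℕ) :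
    RestrictsTo (CherednikAlgebra.incl c (imprimitiveGroup_le (p * d) p n) hc)
      (StandardModule (imprimitiveGroup (p * d) 1 n) c (VRep lam))
      (⨁ l : Fin (eNumber lam), StandardModule (imprimitiveGroup (p * d) p n) c
        (VBarRep mu (l + t))) := by
  obtain ⟨E⟩ := nonempty_standardModule_VRes_equiv_directSum c mu t
  rw [← h.eNumber_eq]
  exact (restrictsTo_VRes hinv hc h).trans_linearEquiv E

end Decomposition

section TypeB

variable {n : ℕ} (lam : MultiPartition 2 1 n)

theorem shift_eq_self_iff_of_two :
    MultiPartition.shift lam = lam ↔ lam.shape 0 0 = lam.shape 1 0 := by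
  constructor
  · intro h
    exact (congrFun (congrFun (congrArg MultiPartition.shape h) 0) 0).symm
  · intro h
    refine MultiPartition.ext (funext fun i => funext fun j => ?_)
    rw [Subsingleton.elim j 0]
    fin_cases i
    · exact h.symm
    · exact h

theorem eNumber_eq_two_iff : eNumber lam = 2 ↔ lam.shape 0 0 = lam.shape 1 0 := by
  rw [← shift_eq_self_iff_of_two, ← Function.iterate_one MultiPartition.shift,
    shift_iterate_eq_self_iff, Nat.dvd_one]
  have hmul := eNumber_mul lam
  constructor
  · intro h
    rw [h] at hmul
    lia
  · intro h
    rwa [h, mul_one] at hmul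

theorem eNumber_eq_one_of_ne (h : lam.shape 0 0 ≠ lam.shape 1 0) : eNumber lam = 1 :=
  ((Nat.dvd_prime Nat.prime_two).1 ⟨_, (eNumber_mul lam).symm⟩).resolve_right
    (mt (eNumber_eq_two_iff lam).1 h)

end TypeB

end ImprimitiveCherednik

open ImprimitiveCherednik in
theorem mainTheorem9 :
    (∀ (p d n : ℕ) [NeZero p] [NeZero d] [NeZero n]
      (c : (EuclideanSpace ℂ (Fin n) ≃ₗᵢ[ℂ] EuclideanSpace ℂ (Fin n)) → ℂ)
      (_ : ∀ w ∈ imprimitiveGroup (p * d) 1 n, ∀ g ∈ imprimitiveGroup (p * d) 1 n,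
        IsReflection g → c (w * g * w⁻¹) = c g)
      (hc : ∀ g ∈ imprimitiveGroup (p * d) 1 n, IsReflection g →
        g ∉ imprimitiveGroup (p * d) p n → c g = 0)
      (lam mu : MultiPartition p d n) (_ : CyclicEquiv lam mu),
      (∀ l : Fin (eNumber lam), (VBarRep mu (l + 1)).IsIrreducible) ∧
      RestrictsTo (CherednikAlgebra.incl c (imprimitiveGroup_le (p * d) p n) hc)
        (StandardModule (imprimitiveGroup (p * d) 1 n) c (VRep lam))
        (⨁ l : Fin (eNumber lam), StandardModule (imprimitiveGroup (p * d) p n) c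
          (VBarRep mu (l + 1)))) ∧
    (∀ (n : ℕ) [NeZero n]
      (c : (EuclideanSpace ℂ (Fin n) ≃ₗᵢ[ℂ] EuclideanSpace ℂ (Fin n)) → ℂ)
      (_ : ∀ w ∈ imprimitiveGroup (2 * 1) 1 n, ∀ g ∈ imprimitiveGroup (2 * 1) 1 n,
        IsReflection g → c (w * g * w⁻¹) = c g)
      (hc : ∀ g ∈ imprimitiveGroup (2 * 1) 1 n, IsReflection g →
        g ∉ imprimitiveGroup (2 * 1) 2 n → c g = 0)
      (lam mu : MultiPartition 2 1 n) (_ : CyclicEquiv lam mu),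
      (eNumber lam = 2 ↔ lam.shape 0 0 = lam.shape 1 0) ∧
      (lam.shape 0 0 ≠ lam.shape 1 0 →
        (VRes mu).IsIrreducible ∧
        RestrictsTo (CherednikAlgebra.incl c (imprimitiveGroup_le (2 * 1) 2 n) hc)
          (StandardModule (imprimitiveGroup (2 * 1) 1 n) c (VRep lam))
          (StandardModule (imprimitiveGroup (2 * 1) 2 n) c (VRes mu))) ∧
      (lam.shape 0 0 = lam.shape 1 0 →
        (∀ l : Fin 2, (VBarRep mu l).IsIrreducible) ∧
        RestrictsTo (CherednikAlgebra.incl c (imprimitiveGroup_le (2 * 1) 2 n) hc)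
          (StandardModule (imprimitiveGroup (2 * 1) 1 n) c (VRep lam))
          (⨁ l : Fin 2, StandardModule (imprimitiveGroup (2 * 1) 2 n) c (VBarRep mu l)))) := by
  refine ⟨fun p d n _ _ _ c hinv hc lam mu h => ⟨fun l => isIrreducible_VBarRep mu _,
    restrictsTo_directSum (fun w hw g hg => hinv w hw g (imprimitiveGroup_le _ _ _ hg)) hc h 1⟩,
    fun n _ c hinv hc lam mu h => ?_⟩
  have hinv' : ∀ w ∈ imprimitiveGroup (2 * 1) 1 n, ∀ g ∈ imprimitiveGroup (2 * 1) 2 n,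
      IsReflection g → c (w * g * w⁻¹) = c g :=
    fun w hw g hg => hinv w hw g (imprimitiveGroup_le _ _ _ hg)
  refine ⟨eNumber_eq_two_iff lam, fun hne => ⟨?_, restrictsTo_VRes hinv' hc h⟩,
    fun heq => ⟨fun l => isIrreducible_VBarRep mu l, ?_⟩⟩
  · exact isIrreducible_VRes (h.eNumber_eq.trans (eNumber_eq_one_of_ne lam hne))
  · have hsum := restrictsTo_directSum hinv' hc h 0
    rwa [(eNumber_eq_two_iff lam).2 heq] at hsum
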